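/- Let $k$ be a field, $R=k[\![x,y,z,w]\!]/(xy)$, $\mathfrak p=(y,z,w)\subset R$ and $M=R/(x)$. Let $N=\mathsf{Tr}(R/\mathfrak p)$ be an Auslander transpose of $R/\mathfrak p$, i.e. $N\cong\operatorname{coker}(P_0^*\to P_1^*)$ for some exact sequence $P_1\to P_0\to R/\mathfrak p\to 0$ with $P_0,P_1$ finitely generated projective and $(-)^*=\operatorname{Hom}_R(-,R)$; such an $N$ exists, and the claims below hold for every choice of it. An $R$-module $L$ satisfies $(S_n)$ if $\operatorname{depth}_{R_{\mathfrak q}}L_{\mathfrak q}\ge\min\{n,\dim R_{\mathfrak q}\}$ for all $\mathfrak q\in\operatorname{Supp}_R L$; it has rank if $L\otimes_R Q$ is free over the total quotient ring $Q$ of $R$. A Noetherian local ring is a complete intersection of codimension $c$ if its completion is $S/(f_1,\dots,f_c)$ with $(S,\mathfrak n)$ regular local and $f_1,\dots,f_c\in\mathfrak n^2$ an $S$-regular sequence. Then $R$ is a complete intersection of codimension $1$ (a hypersurface) of dimension $3$, $\mathfrak p$ is a prime ideal of height $2$, and $M$ is a maximal Cohen–Macaulay $R$-module; in particular $M$ satisfies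 $(S_r)$ for each $r\ge 0$. Moreover $\operatorname{pd}_R N=1$ (and $N$ has rank), $\operatorname{Tor}_i^R(M,N)=0$ for all $i\ge 1$, $M$ and $M\otimes_R N$ are reflexive, $M\otimes_R N$ satisfies $(S_2)$, and $N$ is torsion-free, but $N$ is not reflexive and does not satisfy $(S_2)$. Consequently both parts of the following question of Huneke and Wiegand have a negative answer. Let $A$ be a complete intersection of codimension $c$, and let $M',N'$ be nonzero finitely generated $A$-modules such that $M'\otimes_A N'$ satisfies $(S_n)$ for some $n\ge 1$. (i) If $\operatorname{Tor}_i^A(M',N')=0$ for all $i\ge 1$, must both $M'$ and $N'$ satisfy $(S_n)$? (ii) If $M'$ or $N'$ has rank, $c=1$ and $n=2$, must both $M'$ and $N'$ be reflexive? -/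

import Mathlib

open CategoryTheory TensorProduct
open scoped nonZeroDivisors

universe u

noncomputable section

/-! ### Depth, Serre's condition, rank -/

/-- The depth of a module `M` over a local ring `R`: the supremum of the lengths of the `M`-regular
sequences in the maximal ideal. For `M` nonzero and finitely generated a weakly regular sequence in
the maximal ideal is regular, by Nakayama; for `M = 0` every sequence is weakly regular, so that
`depth 0 = ∞`. -/
def localDepth (R : Type u) [CommRing R] [IsLocalRing R]
    (M : Type u) [AddCommGroup M] [Module R M] : ℕ∞ :=
  ⨆ (rs : List R) (_ : ∀ r ∈ rs, r ∈ IsLocalRing.maximalIdeal R)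
    (_ : RingTheory.Sequence.IsWeaklyRegular M rs), (rs.length : ℕ∞)

/-- Serre's condition `(S_n)` for the module `M`: `depth M_q ≥ min {n, dim R_q}` for each prime `q`
in the support of `M`. -/
def SatisfiesSerre (R : Type u) [CommRing R] (M : Type u) [AddCommGroup M] [Module R M]
    (n : ℕ) : Prop :=
  ∀ q : PrimeSpectrum R, q ∈ Module.support R M →
    min (n : WithBot ℕ∞) (ringKrullDim (Localization.AtPrime q.asIdeal)) ≤
      (localDepth (Localization.AtPrime q.asIdeal)
        (LocalizedModule q.asIdeal.primeCompl M) : WithBot ℕ∞)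

/-- Maximal Cohen-Macaulay modules over a local ring: finitely generated with
`depth M = dim R`. -/
def IsMaximalCohenMacaulay (R : Type u) [CommRing R] [IsLocalRing R]
    (M : Type u) [AddCommGroup M] [Module R M] : Prop :=
  Module.Finite R M ∧ (localDepth R M : WithBot ℕ∞) = ringKrullDim R

/-- `M` has (constant) rank: `M ⊗ Q` is a free module over the total quotient ring `Q` of `R`. -/
def HasConstantRank (R : Type u) [CommRing R] (M : Type u) [AddCommGroup M] [Module R M] : Prop :=
  Module.Free (Localization R⁰) (LocalizedModule R⁰ M)

/-! ### Complete intersections -/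

/-- A Noetherian local ring `R` is a complete intersection of codimension `c` if its completion is
`S / (f₁, …, f_c)` with `S` a regular local ring and `f₁, …, f_c` an `S`-regular sequence contained
in the square of the maximal ideal of `S`. For `c = 1` this is a (singular) hypersurface. -/
def IsCompleteIntersectionOfCodim (R : Type u) [CommRing R] [IsLocalRing R] (c : ℕ) : Prop :=
  IsNoetherianRing R ∧
    ∃ (S : Type u) (_ : CommRing S) (_ : IsRegularLocalRing S) (fs : List S),
      fs.length = c ∧
      (∀ f ∈ fs, f ∈ IsLocalRing.maximalIdeal S ^ 2) ∧
      RingTheory.Sequence.IsRegular S fs ∧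
      Nonempty (AdicCompletion (IsLocalRing.maximalIdeal R) R ≃+* S ⧸ Ideal.ofList fs)

/-! ### The Auslander transpose, Tor -/

/-- `N` is an Auslander transpose of `X`: there is an exact sequence `P₁ → P₀ → X → 0` with `P₁`
and `P₀` finitely generated projective, such that `N` is the cokernel of the dual map
`P₀* → P₁*`. (The transpose is determined by `X` only up to projective summands.) -/
def IsAuslanderTranspose (R : Type u) [CommRing R]
    (X : Type u) [AddCommGroup X] [Module R X] (N : Type u) [AddCommGroup N] [Module R N] : Prop :=
  ∃ (P₁ P₀ : Type u) (_ : AddCommGroup P₁) (_ : AddCommGroup P₀)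
    (_ : Module R P₁) (_ : Module R P₀) (f : P₁ →ₗ[R] P₀) (g : P₀ →ₗ[R] X),
    Module.Finite R P₁ ∧ Module.Projective R P₁ ∧ Module.Finite R P₀ ∧ Module.Projective R P₀ ∧
    Function.Exact f g ∧ Function.Surjective g ∧
    Nonempty (N ≃ₗ[R] (Module.Dual R P₁ ⧸ LinearMap.range f.dualMap))

/-- `Tor_i^R(M, N) = 0` for all `i ≥ 1`. -/
def TorVanishes (R : Type u) [CommRing R] (M : Type u) [AddCommGroup M] [Module R M]
    (N : Type u) [AddCommGroup N] [Module R N] : Prop :=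
  ∀ i : ℕ, 1 ≤ i →
    Limits.IsZero (((Tor (ModuleCat.{u} R) i).obj (ModuleCat.of R M)).obj (ModuleCat.of R N))

/-! ### The two parts of the Huneke-Wiegand question, as assertions -/

/-- First part: over a complete intersection, if `M, N` are nonzero and finitely generated,
`M ⊗ N` satisfies `(S_n)` with `n ≥ 1` and `Tor_i(M, N) = 0` for all `i ≥ 1`, then both `M` and `N`
satisfy `(S_n)`. -/
def HunekeWiegandPartOne : Prop :=
  ∀ (R : Type u) [CommRing R] [IsLocalRing R] (c : ℕ), IsCompleteIntersectionOfCodim R c →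
    ∀ (M N : Type u) [AddCommGroup M] [Module R M] [AddCommGroup N] [Module R N]
      [Module.Finite R M] [Module.Finite R N] [Nontrivial M] [Nontrivial N] (n : ℕ), 1 ≤ n →
      SatisfiesSerre R (M ⊗[R] N) n → TorVanishes R M N →
        SatisfiesSerre R M n ∧ SatisfiesSerre R N n

/-- Second part: over a complete intersection of codimension `1`, if `M, N` are nonzero and finitely
generated, `M ⊗ N` satisfies `(S_2)` and `M` or `N` has rank, then both `M` and `N` are
reflexive. -/
def HunekeWiegandPartTwo : Prop :=
  ∀ (R : Type u) [CommRing R] [IsLocalRing R], IsCompleteIntersectionOfCodim R 1 →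
    ∀ (M N : Type u) [AddCommGroup M] [Module R M] [AddCommGroup N] [Module R N]
      [Module.Finite R M] [Module.Finite R N] [Nontrivial M] [Nontrivial N],
      SatisfiesSerre R (M ⊗[R] N) 2 → (HasConstantRank R M ∨ HasConstantRank R N) →
        Module.IsReflexive R M ∧ Module.IsReflexive R N

/-! ### The ring, the prime and the module of the example -/

/-- `k⟦x, y, z, w⟧ / (xy)`, with `x, y, z, w` the variables number `0, 1, 2, 3`. -/
abbrev ExRing (k : Type u) [Field k] : Type u :=
  MvPowerSeries (Fin 4) k ⧸
    Ideal.span {(MvPowerSeries.X 0 * MvPowerSeries.X 1 : MvPowerSeries (Fin 4) k)}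

/-- The class of the `i`-th variable in `k⟦x, y, z, w⟧ / (xy)`. -/
abbrev exVar (k : Type u) [Field k] (i : Fin 4) : ExRing k :=
  Ideal.Quotient.mk _ (MvPowerSeries.X i)

/-- `𝔭 = (y, z, w)`. -/
abbrev exPrime (k : Type u) [Field k] : Ideal (ExRing k) :=
  Ideal.span {exVar k 1, exVar k 2, exVar k 3}

/-- `M = R / (x)`. -/
abbrev ExModule (k : Type u) [Field k] : Type u :=
  ExRing k ⧸ Ideal.span {exVar k 0}

instance exRing_isLocalRing (k : Type u) [Field k] : IsLocalRing (ExRing k) := by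
  have : Nontrivial (ExRing k) := by
    refine Ideal.Quotient.nontrivial_iff.mpr fun h => ?_
    rw [Ideal.span_singleton_eq_top] at h
    have h' := h.map (MvPowerSeries.constantCoeff (σ := Fin 4) (R := k))
    simp at h'
  exact IsLocalRing.of_surjective' _ Ideal.Quotient.mk_surjective

end

/-!
Write `R = k⟦x, y, z, w⟧ / (xy)`, `𝔭 = (y, z, w)` and `M = R / (x)`.

*The ring and the module.* Ideals generated by some of the variables are controlled through
`MvPowerSeries.mem_span_X_image_iff`: in `R`, such an ideal is prime as soon as it contains `x` or
`y`, and otherwise it is the intersection of two primes of this kind. So `z, w, x + y` is a regular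
sequence on `R`, while `y, z, w` is one on `M`. As `dim R = 3`, both are Cohen-Macaulay. To pass
from the depth of `M` over `R` to Serre's condition one needs `grade (q, M) ≥ depth M - dim R / q`
for all primes `q`; this is `exists_isWeaklyRegular_forall_mem_prime`, which rests on the exchange
property of regular sequences and on Ischebeck's inequality `depth M ≤ dim R / P` for associated
primes `P` of `M`.

*The transpose.* The generators `y, z, w` of `𝔭` being minimal, any presentation of `R / 𝔭` is the
row `(y, z, w) : R³ → R` plus trivial summands. So every transpose `N` is `N₀ ⊕ G` with `G` free and
`N₀ = R³ / R(y, z, w)`, see `IsAuslanderTranspose.exists_linearEquiv_columnCokernel_prod`.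
The sequence `0 → R → R³ ⊕ G → N → 0` is a projective resolution, which remains exact after
tensoring with `M`, because `z` is regular on `M`; this gives the projective dimension and the
vanishing of `Tor`. Up to `z`-torsion `N₀` is free on the first and third basis vectors, so `N` has
rank.

*Reflexivity.* `M` is reflexive because `x` and `y` annihilate exactly each other. `M ⊗ N₀` is the
cokernel of the column `(y, z, w)` over `R / (x) = k⟦y, z, w⟧`, a second syzygy in the Koszul
complex of the regular sequence `y, z, w`; a computation with Koszul cycles shows that it is
reflexive over `R` (`isReflexive_of_koszul`). Over the Cohen-Macaulay ring `R` reflexive modules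
satisfy `(S₂)`, since regular sequences of length at most two on `R` remain regular on dual modules.
In contrast, `N₀` is not reflexive: for a functional `l` on `N₀`, with `e₁` and `e₂` the classes of
the second and third basis vectors, the relation `x (z l(e₁) + w l(e₂)) = 0` makes `x l(e₁)` divisible by `w`, and `l ↦ x l(e₁) / w` would only be an evaluation if
`x` were in `(z, w)`. Finally `x` is invertible in `R_𝔭`, so `y` vanishes there and `N₀` becomes
`R_𝔭 ⊕ (z, w)R_𝔭`, up to isomorphism, which has depth one although `dim R_𝔭 = 2`
(`localDepth_le_one_of_relation`).

The pair `M, N` is the counterexample to both parts of the question.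
-/

/-! ### Regular sequences over local rings -/

section RegularSequences

open IsLocalRing RingTheory.Sequence Module
open scoped Pointwise

variable {R : Type*} [CommRing R]

lemma mem_smul_top_iff_exists_smul_eq {M : Type*} [AddCommGroup M] [Module R M] {r : R} {m : M} :
    m ∈ r • (⊤ : Submodule R M) ↔ ∃ n, r • n = m := by
  rw [← SetLike.mem_coe, Submodule.coe_pointwise_smul, Set.mem_smul_set]
  simp

lemma isSMulRegular_quotSMulTop_iff {M : Type*} [AddCommGroup M] [Module R M] {r s : R} :
    IsSMulRegular (QuotSMulTop r M) s ↔ ∀ m n : M, s • m = r • n → ∃ n', m = r • n' := by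
  rw [isSMulRegular_quotient_iff_mem_of_smul_mem]
  simp only [mem_smul_top_iff_exists_smul_eq]
  constructor
  · intro h m n hmn
    obtain ⟨n', hn'⟩ := h m ⟨n, hmn.symm⟩
    exact ⟨n', hn'.symm⟩
  · rintro h m ⟨n, hn⟩
    obtain ⟨n', hn'⟩ := h m n hn.symm
    exact ⟨n', hn'.symm⟩

lemma isSMulRegular_iff_forall_notMem_associatedPrimes [IsNoetherianRing R]
    {M : Type*} [AddCommGroup M] [Module R M] {r : R} :
    IsSMulRegular M r ↔ ∀ P ∈ associatedPrimes R M, r ∉ P := by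
  have := Set.ext_iff.mp (biUnion_associatedPrimes_eq_compl_regular R M) r
  simp only [Set.mem_iUnion, SetLike.mem_coe, Set.mem_compl_iff, Set.mem_ofPred_eq,
    exists_prop] at this
  rw [← not_iff_not, ← this]
  push Not
  rfl

lemma exists_eq_colon_singleton_of_mem_associatedPrimes [IsNoetherianRing R] {M : Type*}
    [AddCommGroup M] [Module R M] {P : Ideal R} (hP : P ∈ associatedPrimes R M) :
    ∃ m : M, m ≠ 0 ∧ ∀ r, r ∈ P ↔ r • m = 0 := by
  obtain ⟨hprime, m, hm⟩ := isAssociatedPrime_iff.mp hP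
  refine ⟨m, ?_, fun r => by rw [hm, Submodule.mem_colon_singleton, Submodule.mem_bot]⟩
  rintro rfl
  exact hprime.ne_top (by rw [hm, Ideal.eq_top_iff_one, Submodule.mem_colon_singleton]; simp)

variable [IsLocalRing R] [IsNoetherianRing R]

/-- If the maximal ideal consists of zero divisors modulo `aM`, where `a` is `M`-regular, then the
same holds modulo `xM` for every `M`-regular `x` in the maximal ideal. -/
lemma maximalIdeal_notMem_associatedPrimes_quotSMulTop {M : Type*} [AddCommGroup M] [Module R M]
    {a x y : R} (ha : IsSMulRegular M a) (hx : IsSMulRegular M x)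
    (hxm : x ∈ maximalIdeal R) (hym : y ∈ maximalIdeal R)
    (hy : IsSMulRegular (QuotSMulTop x M) y) :
    maximalIdeal R ∉ associatedPrimes R (QuotSMulTop a M) := by
  intro hP
  obtain ⟨m, hm0, hm⟩ := exists_eq_colon_singleton_of_mem_associatedPrimes hP
  obtain ⟨c, rfl⟩ := Submodule.Quotient.mk_surjective _ m
  have key : ∀ r ∈ maximalIdeal R, ∃ d, a • d = r • c := fun r hr => by
    have := (hm r).mp hr
    rwa [← Submodule.Quotient.mk_smul, Submodule.Quotient.mk_eq_zero,
      mem_smul_top_iff_exists_smul_eq] at this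
  obtain ⟨c', hc'⟩ := key x hxm
  obtain ⟨e, he⟩ := key y hym
  have h1 : y • c' = x • e := ha (by
    change a • y • c' = a • x • e
    rw [smul_comm, hc', smul_comm a x, he, smul_comm])
  obtain ⟨d, hd⟩ := isSMulRegular_quotSMulTop_iff.mp hy _ _ h1
  have h2 : a • d = c := hx (by
    change x • a • d = x • c
    rw [smul_comm, ← hd, hc'])
  exact hm0 ((Submodule.Quotient.mk_eq_zero _).mpr (mem_smul_top_iff_exists_smul_eq.mpr ⟨d, h2⟩))

/-- Exchange property of regular sequences: any regular element of the maximal ideal can be taken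
as the first member of a regular sequence of a length that is attained by some other sequence. In
other words, `depth (M / aM) ≥ depth M - 1`. -/
theorem exists_isWeaklyRegular_cons_of_isWeaklyRegular (n : ℕ) :
    ∀ (M : Type u) [AddCommGroup M] [Module R M] [Module.Finite R M] (a : R) (rs : List R),
      a ∈ maximalIdeal R → IsSMulRegular M a → (∀ r ∈ rs, r ∈ maximalIdeal R) →
      IsWeaklyRegular M rs → rs.length = n + 1 →
      ∃ ts : List R, ts.length = n ∧ (∀ r ∈ ts, r ∈ maximalIdeal R) ∧
        IsWeaklyRegular M (a :: ts) := by
  induction n with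
  | zero =>
    intro M _ _ _ a rs _ ha _ _ _
    exact ⟨[], rfl, by simp, by simpa using ha⟩
  | succ n ih =>
    intro M _ _ _ a rs ham ha hrs hreg hlen
    obtain ⟨x, y, rs', rfl⟩ : ∃ x y rs', rs = x :: y :: rs' := by
      match rs, hlen with
      | x :: y :: rs', _ => exact ⟨x, y, rs', rfl⟩
    have hxm : x ∈ maximalIdeal R := hrs x (by simp)
    have hym : y ∈ maximalIdeal R := hrs y (by simp)
    rw [isWeaklyRegular_cons_iff] at hreg
    obtain ⟨hx, hreg⟩ := hreg
    have hy := ((isWeaklyRegular_cons_iff _ _ _).mp hreg).1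
    -- by prime avoidance, some `b` is regular modulo `x` and modulo `a` at the same time
    obtain ⟨b, hbm, hbx, hba⟩ : ∃ b ∈ maximalIdeal R, IsSMulRegular (QuotSMulTop x M) b ∧
        IsSMulRegular (QuotSMulTop a M) b := by
      by_contra! hcon
      have hsub : (maximalIdeal R : Set R) ⊆
          ⋃ P ∈ associatedPrimes R (QuotSMulTop x M) ∪ associatedPrimes R (QuotSMulTop a M),
            ((id P : Ideal R) : Set R) := by
        intro b hb
        by_contra hbn
        simp only [Set.mem_iUnion, exists_prop, not_exists, not_and, id, SetLike.mem_coe] at hbn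
        exact hcon b hb
          (isSMulRegular_iff_forall_notMem_associatedPrimes.mpr fun P hP => hbn P (Or.inl hP))
          (isSMulRegular_iff_forall_notMem_associatedPrimes.mpr fun P hP => hbn P (Or.inr hP))
      rw [Ideal.subset_union_prime_finite
        ((associatedPrimes.finite R _).union (associatedPrimes.finite R _)) ⊤ ⊤] at hsub
      · obtain ⟨P, hP, hle⟩ := hsub
        have hPp : P.IsPrime := hP.elim IsAssociatedPrime.isPrime IsAssociatedPrime.isPrime
        obtain rfl : maximalIdeal R = P :=
          (IsLocalRing.maximalIdeal.isMaximal R).eq_of_le hPp.ne_top hle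
        rcases hP with hP | hP
        · exact maximalIdeal_notMem_associatedPrimes_quotSMulTop hx hx hxm hym hy hP
        · exact maximalIdeal_notMem_associatedPrimes_quotSMulTop ha hx hxm hym hy hP
      · rintro P (hP | hP) _ _ <;> exact IsAssociatedPrime.isPrime hP
    have swap : ∀ {c : R} {ts : List R}, c ∈ maximalIdeal R → (∀ r ∈ ts, r ∈ maximalIdeal R) →
        IsSMulRegular M c → IsWeaklyRegular (QuotSMulTop c M) (b :: ts) →
        IsSMulRegular M b ∧ IsWeaklyRegular (QuotSMulTop b M) (c :: ts) := by
      intro c ts hc hts h1 h2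
      rw [← isWeaklyRegular_cons_iff]
      refine IsLocalRing.isWeaklyRegular_of_perm_of_subset_maximalIdeal
        ((isWeaklyRegular_cons_iff _ _ _).mpr ⟨h1, h2⟩) (List.Perm.swap _ _ _) ?_
      exact List.forall_mem_cons.mpr ⟨hc, List.forall_mem_cons.mpr ⟨hbm, hts⟩⟩
    obtain ⟨ts, htl, htm, htr⟩ := ih (QuotSMulTop x M) b (y :: rs') hbm hbx
      (fun r hr => hrs r (List.mem_cons_of_mem _ hr)) hreg (by simpa using hlen)
    obtain ⟨hb, htr'⟩ := swap hxm htm hx htr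
    have hba' := (swap (ts := []) ham (by simp) ha (by simpa using hba)).2
    obtain ⟨zs, hzl, hzm, hzr⟩ := ih (QuotSMulTop b M) a (x :: ts) ham
      ((isWeaklyRegular_singleton_iff _ _).mp hba') (List.forall_mem_cons.mpr ⟨hxm, htm⟩) htr'
      (by simpa using htl)
    refine ⟨b :: zs, by simpa using hzl, List.forall_mem_cons.mpr ⟨hbm, hzm⟩, ?_⟩
    refine IsLocalRing.isWeaklyRegular_of_perm_of_subset_maximalIdeal
      ((isWeaklyRegular_cons_iff _ _ _).mpr ⟨hb, hzr⟩) (List.Perm.swap _ _ _) ?_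
    exact List.forall_mem_cons.mpr ⟨hbm, List.forall_mem_cons.mpr ⟨ham, hzm⟩⟩

/-- If `x` is `M`-regular, every associated prime `P` of `M` lies below an associated prime of
`M / xM` that contains `x`: by Nakayama the submodule of `M` killed by `P` is not contained in
`xM`. -/
lemma exists_mem_associatedPrimes_quotSMulTop_lt {M : Type*} [AddCommGroup M] [Module R M]
    [Module.Finite R M] {x : R} (hxm : x ∈ maximalIdeal R) (hx : IsSMulRegular M x) {P : Ideal R}
    (hP : P ∈ associatedPrimes R M) : ∃ P' ∈ associatedPrimes R (QuotSMulTop x M), P < P' := by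
  obtain ⟨m₀, hm₀, hPm₀⟩ := exists_eq_colon_singleton_of_mem_associatedPrimes hP
  let L : Submodule R M :=
    { carrier := {m | ∀ r ∈ P, r • m = 0}
      add_mem' := fun {a b} ha hb r hr => by rw [smul_add, ha r hr, hb r hr, add_zero]
      zero_mem' := fun r _ => smul_zero r
      smul_mem' := fun c m hm r hr => by rw [smul_comm, hm r hr, smul_zero] }
  have hxP : x ∉ P := fun h => hm₀ (hx (by
    change x • m₀ = x • (0 : M)
    rw [(hPm₀ x).mp h, smul_zero]))
  obtain ⟨m, hmL, hmx⟩ : ∃ m ∈ L, ∀ n, x • n ≠ m := by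
    by_contra! hcon
    have hL : L = ⊥ := by
      refine Submodule.eq_bot_of_le_smul_of_le_jacobson_bot (Ideal.span {x}) L
        (IsNoetherian.noetherian L) (fun m hm => ?_) ?_
      · obtain ⟨n, rfl⟩ := hcon m hm
        refine Submodule.smul_mem_smul (Ideal.mem_span_singleton_self x) fun r hr => hx ?_
        change x • r • n = x • (0 : M)
        rw [smul_comm, hm r hr, smul_zero]
      · exact ((Ideal.span_singleton_le_iff_mem _).mpr hxm).trans (maximalIdeal_le_jacobson _)
    have : m₀ ∈ L := fun r hr => (hPm₀ r).mp hr
    rw [hL] at this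
    exact hm₀ this
  have hne : (Submodule.Quotient.mk m : QuotSMulTop x M) ≠ 0 := by
    rw [Ne, Submodule.Quotient.mk_eq_zero, mem_smul_top_iff_exists_smul_eq]
    exact fun ⟨n, hn⟩ => hmx n hn
  obtain ⟨P', hP', hle⟩ := exists_le_isAssociatedPrime_of_isNoetherianRing R _ hne
  refine ⟨P', hP', lt_of_le_of_ne (fun r hr => hle ?_) ?_⟩
  · rw [Submodule.mem_colon_singleton, Submodule.mem_bot, ← Submodule.Quotient.mk_smul, hmL r hr,
      Submodule.Quotient.mk_zero]
  · rintro rfl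
    refine hxP (hle ?_)
    rw [Submodule.mem_colon_singleton, Submodule.mem_bot, ← Submodule.Quotient.mk_smul,
      Submodule.Quotient.mk_eq_zero, mem_smul_top_iff_exists_smul_eq]
    exact ⟨m, rfl⟩

/-- Ischebeck's inequality `depth M ≤ dim R / P` for an associated prime `P` of `M`. -/
theorem length_le_coheight_of_mem_associatedPrimes (rs : List R) :
    ∀ (M : Type u) [AddCommGroup M] [Module R M] [Module.Finite R M] (P : PrimeSpectrum R),
      (∀ r ∈ rs, r ∈ maximalIdeal R) → IsWeaklyRegular M rs →
      P.asIdeal ∈ associatedPrimes R M → (rs.length : ℕ∞) ≤ Order.coheight P := by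
  induction rs with
  | nil => intros; simp
  | cons x rs ih =>
    intro M _ _ _ P hrs hreg hP
    rw [isWeaklyRegular_cons_iff] at hreg
    obtain ⟨P', hP', hlt⟩ := exists_mem_associatedPrimes_quotSMulTop_lt (hrs x (by simp)) hreg.1 hP
    have h1 := ih (QuotSMulTop x M) ⟨P', IsAssociatedPrime.isPrime hP'⟩
      (fun r hr => hrs r (List.mem_cons_of_mem _ hr)) hreg.2 hP'
    have h2 : Order.coheight (⟨P', IsAssociatedPrime.isPrime hP'⟩ : PrimeSpectrum R) + 1 ≤
        Order.coheight P := Order.coheight_add_one_le hlt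
    calc ((x :: rs).length : ℕ∞) = rs.length + 1 := by simp
      _ ≤ _ := by gcongr
      _ ≤ _ := h2

/-- The grade of a prime `q` on `M` is at least `depth M - dim R / q`: an `M`-regular sequence in
`q` which cannot be prolonged within `q` puts `q` inside an associated prime of the quotient, to
which Ischebeck's inequality applies. -/
theorem exists_isWeaklyRegular_forall_mem_prime (n : ℕ) :
    ∀ (M : Type u) [AddCommGroup M] [Module R M] [Module.Finite R M] (rs : List R)
      (q : PrimeSpectrum R), (∀ r ∈ rs, r ∈ maximalIdeal R) → IsWeaklyRegular M rs →
      rs.length = n → ∃ ts : List R, (∀ r ∈ ts, r ∈ q.asIdeal) ∧ IsWeaklyRegular M ts ∧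
        (n : ℕ∞) ≤ ts.length + Order.coheight q := by
  induction n with
  | zero => intro M _ _ _ rs q _ _ _; exact ⟨[], by simp, by simp, by simp⟩
  | succ n ih =>
    intro M _ _ _ rs q hrs hreg hlen
    by_cases hq : ∃ a ∈ q.asIdeal, IsSMulRegular M a
    · obtain ⟨a, haq, ha⟩ := hq
      obtain ⟨ts, htl, htm, htr⟩ := exists_isWeaklyRegular_cons_of_isWeaklyRegular n M a rs
        (IsLocalRing.le_maximalIdeal q.2.ne_top haq) ha hrs hreg hlen
      obtain ⟨us, husq, hus, hle⟩ := ih (QuotSMulTop a M) ts q htm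
        ((isWeaklyRegular_cons_iff _ _ _).mp htr).2 htl
      refine ⟨a :: us, by simpa [haq] using husq,
        (isWeaklyRegular_cons_iff _ _ _).mpr ⟨ha, hus⟩, ?_⟩
      calc ((n + 1 : ℕ) : ℕ∞) = n + 1 := by simp
        _ ≤ us.length + Order.coheight q + 1 := by gcongr
        _ = _ := by rw [List.length_cons, Nat.cast_add, Nat.cast_one, add_right_comm]
    · push Not at hq
      have hsub : (q.asIdeal : Set R) ⊆ ⋃ P ∈ associatedPrimes R M, ((id P : Ideal R) : Set R) := by
        intro b hb
        by_contra hbn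
        simp only [Set.mem_iUnion, exists_prop, not_exists, not_and, id, SetLike.mem_coe] at hbn
        exact hq b hb (isSMulRegular_iff_forall_notMem_associatedPrimes.mpr hbn)
      rw [Ideal.subset_union_prime_finite (f := id) (associatedPrimes.finite R _) ⊤ ⊤
        (fun P hP _ _ => IsAssociatedPrime.isPrime hP)] at hsub
      obtain ⟨P, hP, hle⟩ := hsub
      refine ⟨[], by simp, by simp, ?_⟩
      have h1 := length_le_coheight_of_mem_associatedPrimes rs M
        ⟨P, IsAssociatedPrime.isPrime hP⟩ hrs hreg hP
      rw [hlen] at h1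
      have h2 : q ≤ ⟨P, IsAssociatedPrime.isPrime hP⟩ := hle
      simpa using h1.trans (Order.coheight_anti h2)

/-- Over a local ring of dimension at most the depth of `M`, every prime `q` contains an
`M`-regular sequence whose length is at least the height of `q`. -/
theorem exists_isWeaklyRegular_height_le_length {M : Type u} [AddCommGroup M] [Module R M]
    [Module.Finite R M] {rs : List R} (hrs : ∀ r ∈ rs, r ∈ maximalIdeal R)
    (hreg : IsWeaklyRegular M rs) (hdim : ringKrullDim R ≤ rs.length) (q : PrimeSpectrum R) :
    ∃ ts : List R, (∀ r ∈ ts, r ∈ q.asIdeal) ∧ IsWeaklyRegular M ts ∧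
      q.asIdeal.height ≤ ts.length := by
  obtain ⟨ts, h1, h2, h3⟩ := exists_isWeaklyRegular_forall_mem_prime rs.length M rs q hrs hreg rfl
  refine ⟨ts, h1, h2, ?_⟩
  rw [PrimeSpectrum.height_eq_orderHeight]
  have h4 : Order.height q + Order.coheight q ≤ rs.length := by
    have h : ((Order.height q + Order.coheight q : ℕ∞) : WithBot ℕ∞) ≤ ringKrullDim R := by
      rw [ringKrullDim, Order.krullDim_eq_iSup_height_add_coheight_of_nonempty]
      exact WithBot.coe_le_coe.mpr
        (le_iSup (fun a : PrimeSpectrum R => Order.height a + Order.coheight a) q)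
    exact_mod_cast h.trans hdim
  have h5 : Order.coheight q ≠ ⊤ := by
    intro h; rw [h, add_top, top_le_iff] at h4; exact ENat.natCast_ne_top _ h4
  exact (ENat.add_le_add_iff_right h5).mp (h4.trans h3)

end RegularSequences

/-! ### Power series rings -/

section PowerSeriesRings

open IsLocalRing RingTheory.Sequence

namespace MvPowerSeries

variable {σ : Type*} {A : Type*} [CommRing A]

/-- The ideal generated by some of the variables consists of the power series without monomials in
the other variables only. -/
lemma mem_span_X_image_iff (s : Finset σ) (f : MvPowerSeries σ A) :
    f ∈ Ideal.span ((X : σ → MvPowerSeries σ A) '' s) ↔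
      ∀ m : σ →₀ ℕ, (∀ i ∈ s, m i = 0) → coeff m f = 0 := by
  classical
  constructor
  · intro hf
    induction hf using Submodule.span_induction with
    | mem x hx =>
      obtain ⟨i, hi, rfl⟩ := hx
      exact fun m hm => X_dvd_iff.mp dvd_rfl m (hm i hi)
    | zero => simp
    | add x y _ _ hx hy => exact fun m hm => by rw [map_add, hx m hm, hy m hm, add_zero]
    | smul a x _ hx =>
      intro m hm
      rw [smul_eq_mul, coeff_mul]
      refine Finset.sum_eq_zero fun p hp => ?_
      rw [hx p.2 fun i hi => ?_, mul_zero]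
      have := DFunLike.congr_fun (Finset.HasAntidiagonal.mem_antidiagonal.mp hp) i
      simp only [Finsupp.add_apply, hm i hi] at this
      omega
  · induction s using Finset.induction_on generalizing f with
    | empty =>
      intro hf
      have : f = 0 := by ext m; simpa using hf m (by simp)
      simp [this]
    | insert i s _ ih =>
      intro hf
      -- `g` collects the monomials of `f` in which the `i`-th variable does not occur
      let g : MvPowerSeries σ A := fun m => if m i = 0 then coeff m f else 0
      have hg : ∀ m, coeff m g = if m i = 0 then coeff m f else 0 := fun m => rfl
      obtain ⟨h, hh⟩ : X i ∣ f - g := X_dvd_iff.mpr fun m hm => by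
        rw [map_sub, hg, if_pos hm, sub_self]
      have hgs : g ∈ Ideal.span ((X : σ → MvPowerSeries σ A) '' s) := ih g fun m hm => by
        rw [hg]
        split_ifs with h0
        · exact hf m fun j hj => (Finset.mem_insert.mp hj).elim (fun e => e ▸ h0) (hm j)
        · rfl
      rw [← sub_add_cancel f g, hh]
      refine Ideal.add_mem _ (Ideal.mul_mem_right _ _ (Ideal.subset_span ⟨i, by simp, rfl⟩))
        (Ideal.span_mono (Set.image_mono (by simp)) hgs)

lemma ker_killCompl_subtype (s : Finset σ) :
    RingHom.ker (killCompl (R := A) (Function.Embedding.subtype (· ∉ s))) =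
      Ideal.span ((X : σ → MvPowerSeries σ A) '' s) := by
  classical
  ext f
  rw [RingHom.mem_ker, mem_span_X_image_iff, MvPowerSeries.ext_iff]
  simp only [coeff_killCompl, coeff_zero]
  constructor
  · intro h m hm
    have h' := h (m.comapDomain Subtype.val Subtype.val_injective.injOn)
    convert h' using 1
    refine congrArg (fun n => coeff n f) (Eq.symm ?_)
    refine Finsupp.embDomain_comapDomain (f := Function.Embedding.subtype (· ∉ s)) (g := m) ?_
    intro i hi
    simp only [Function.Embedding.subtype_apply, Set.mem_range, Subtype.exists, exists_prop,
      exists_eq_right]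
    exact fun his => (Finsupp.mem_support_iff.mp hi) (hm i his)
  · intro h x
    refine h _ fun i hi => Finsupp.embDomain_of_notMem_range _ _ _ ?_
    rintro ⟨j, rfl⟩
    exact j.2 hi

lemma isPrime_span_X_image [IsDomain A] (s : Finset σ) :
    (Ideal.span ((X : σ → MvPowerSeries σ A) '' s)).IsPrime := by
  rw [← ker_killCompl_subtype]
  have : IsDomain (MvPowerSeries {i // i ∉ s} A) := NoZeroDivisors.to_isDomain _
  exact RingHom.ker_isPrime _

lemma ofList_map_X [DecidableEq σ] (l : List σ) :
    Ideal.ofList (l.map (X : σ → MvPowerSeries σ A)) =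
      Ideal.span ((X : σ → MvPowerSeries σ A) '' l.toFinset) := by
  simp only [Ideal.ofList, List.mem_map, List.coe_toFinset]
  rfl

/-- Distinct variables form a regular sequence. -/
lemma isWeaklyRegular_map_X {l : List σ} (hl : l.Nodup) :
    IsWeaklyRegular (MvPowerSeries σ A) (l.map (X : σ → MvPowerSeries σ A)) := by
  classical
  refine ⟨fun i hi => ?_⟩
  rw [isSMulRegular_quotient_iff_mem_of_smul_mem]
  intro f
  rw [List.length_map] at hi
  simp only [← List.map_take, ofList_map_X, smul_eq_mul, Ideal.mul_top, mem_span_X_image_iff,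
    List.getElem_map, List.mem_toFinset]
  intro h m hm
  have := h (Finsupp.single l[i] 1 + m) fun j hj => by
    rw [Finsupp.add_apply, hm j hj, add_zero, Finsupp.single_apply, if_neg]
    rintro rfl
    obtain ⟨k, hk, hkj⟩ := List.mem_take_iff_getElem.mp hj
    have := (hl.getElem_inj_iff).mp hkj
    omega
  rwa [X, coeff_add_monomial_mul, one_mul] at this

end MvPowerSeries

variable (k : Type*) [Field k]

namespace MvPowerSeries

lemma maximalIdeal_eq_span_X {σ : Type*} [Fintype σ] :
    maximalIdeal (MvPowerSeries σ k) = Ideal.span (Set.range X) := by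
  have : Set.range (X : σ → MvPowerSeries σ k) = X '' ((Finset.univ : Finset σ) : Set σ) := by simp
  ext f
  rw [this, mem_span_X_image_iff, mem_maximalIdeal, mem_nonunits_iff, isUnit_iff_constantCoeff,
    isUnit_iff_ne_zero, not_not, ← coeff_zero_eq_constantCoeff_apply]
  constructor
  · intro h m hm
    obtain rfl : m = 0 := by ext i; simpa using hm i
    exact h
  · intro h; exact h 0 (by simp)

theorem ringKrullDim_fin (n : ℕ) : ringKrullDim (MvPowerSeries (Fin n) k) = n := by
  have hmax : Ideal.ofList ((List.finRange n).map (X : Fin n → MvPowerSeries (Fin n) k)) =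
      maximalIdeal _ := by
    rw [ofList_map_X, maximalIdeal_eq_span_X]
    congr 1
    ext; simp
  have hreg : IsRegular (MvPowerSeries (Fin n) k)
      ((List.finRange n).map (X : Fin n → MvPowerSeries (Fin n) k)) := by
    refine IsRegular.of_isWeaklyRegular_of_mem_maximalIdeal _ ?_
      (isWeaklyRegular_map_X (List.nodup_finRange n))
    rw [← hmax]
    exact fun r hr => Ideal.subset_span hr
  have h := ringKrullDim_add_length_eq_ringKrullDim_of_isRegular _ hreg
  rw [hmax, ringKrullDim_eq_zero_of_isField
    ((Ideal.Quotient.maximal_ideal_iff_isField_quotient _).mp inferInstance)] at h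
  rw [← h]
  simp

instance isRegularLocalRing_fin (n : ℕ) : IsRegularLocalRing (MvPowerSeries (Fin n) k) := by
  refine IsRegularLocalRing.of_spanFinrank_maximalIdeal_le _ ?_
  rw [ringKrullDim_fin, maximalIdeal_eq_span_X]
  have h := (Submodule.spanFinrank_span_le_ncard_of_finite
    (R := MvPowerSeries (Fin n) k) (Set.finite_range (X : Fin n → MvPowerSeries (Fin n) k)))
  have h2 : (Set.range (X : Fin n → MvPowerSeries (Fin n) k)).ncard ≤ n := by
    rw [← Set.image_univ]
    exact (Set.ncard_image_le Set.finite_univ).trans (by simp [Set.ncard_univ])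
  exact_mod_cast h.trans h2

instance isAdicComplete_maximalIdeal (n : ℕ) :
    IsAdicComplete (maximalIdeal (MvPowerSeries (Fin n) k)) (MvPowerSeries (Fin n) k) := by
  rw [maximalIdeal_eq_span_X]
  infer_instance

end MvPowerSeries

lemma map_maximalIdeal_quotient_mk {A : Type*} [CommRing A] [IsLocalRing A] (I : Ideal A)
    [IsLocalRing (A ⧸ I)] :
    (maximalIdeal A).map (Ideal.Quotient.mk I) = maximalIdeal (A ⧸ I) := by
  have h : (maximalIdeal (A ⧸ I)).comap (Ideal.Quotient.mk I) = maximalIdeal A :=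
    eq_maximalIdeal (Ideal.comap_isMaximal_of_surjective _ Ideal.Quotient.mk_surjective)
  rw [← h, Ideal.map_comap_of_surjective _ Ideal.Quotient.mk_surjective]

/-- A quotient of a complete Noetherian local ring is complete. -/
lemma isAdicComplete_quotient {A : Type*} [CommRing A] [IsLocalRing A] [IsNoetherianRing A]
    [IsAdicComplete (maximalIdeal A) A] (I : Ideal A) [IsLocalRing (A ⧸ I)] :
    IsAdicComplete (maximalIdeal (A ⧸ I)) (A ⧸ I) := by
  have h : IsPrecomplete (maximalIdeal A) (A ⧸ I) := by
    rw [← AdicCompletion.of_surjective_iff]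
    intro y
    obtain ⟨y', rfl⟩ := AdicCompletion.map_surjective (maximalIdeal A)
      (f := (Submodule.mkQ I : A →ₗ[A] A ⧸ I)) (Submodule.mkQ_surjective I) y
    obtain ⟨t, rfl⟩ := AdicCompletion.of_surjective (maximalIdeal A) A y'
    exact ⟨Submodule.mkQ I t, (AdicCompletion.map_of _ _ _).symm⟩
  rw [← IsPrecomplete.map_algebraMap_iff (S := A ⧸ I), Ideal.Quotient.algebraMap_eq,
    map_maximalIdeal_quotient_mk] at h
  exact { toIsPrecomplete := h }

/-- The quotient of a complete regular local ring by a nonzero nonunit of the square of its maximal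
ideal is a complete intersection of codimension one. -/
lemma isCompleteIntersectionOfCodim_one_quotient_span_singleton {S : Type u} [CommRing S]
    [IsDomain S] [IsRegularLocalRing S] [IsAdicComplete (maximalIdeal S) S] {f : S} (hf0 : f ≠ 0)
    (hf : f ∈ maximalIdeal S ^ 2) [IsLocalRing (S ⧸ Ideal.span {f})] :
    IsCompleteIntersectionOfCodim (S ⧸ Ideal.span {f}) 1 := by
  refine ⟨inferInstance, S, inferInstance, inferInstance, [f], rfl, by simpa using hf, ?_, ?_⟩
  · refine IsRegular.of_isWeaklyRegular_of_mem_maximalIdeal S ?_ ?_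
    · simpa using Ideal.pow_le_self two_ne_zero hf
    · rw [isWeaklyRegular_singleton_iff]
      exact fun a b hab => mul_left_cancel₀ hf0 hab
  · have := isAdicComplete_quotient (Ideal.span {f})
    rw [Ideal.ofList_singleton]
    exact ⟨(AdicCompletion.ofAlgEquiv _).symm.toRingEquiv⟩

end PowerSeriesRings

/-! ### Modules with a resolution of length one -/

section ShortResolutions

section Complexes

open Limits HomologicalComplex

variable {C D : Type*} [Category* C] [Abelian C] [Category* D] [Abelian D]

lemma ChainComplex.exactAt_succ_of_mono {K : ChainComplex C ℕ} (h : Mono (K.d 1 0))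
    (hK : ∀ n, IsZero (K.X (n + 2))) (n : ℕ) : K.ExactAt (n + 1) := by
  match n with
  | 0 =>
    rw [exactAt_iff' K 2 1 0 (by simp) (by simp)]
    refine (ShortComplex.exact_iff_mono _ ((hK 0).eq_of_src _ _)).mpr h
  | n + 1 => exact ShortComplex.exact_of_isZero_X₂ _ (hK n)

lemma ComplexShape.down_rel_one_zero : (ComplexShape.down ℕ).Rel 1 0 := by simp

namespace CategoryTheory.ShortComplex.ShortExact

/-- A short exact sequence with projective first and middle terms is a projective resolution of its
last term. -/
noncomputable def projectiveResolution {S : ShortComplex C} (hS : S.ShortExact)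
    [Projective S.X₁] [Projective S.X₂] : ProjectiveResolution S.X₃ where
  complex := double S.f ComplexShape.down_rel_one_zero
  projective n := by
    match n with
    | 0 => exact Projective.of_iso (doubleXIso₁ S.f _ one_ne_zero).symm inferInstance
    | 1 => exact Projective.of_iso (doubleXIso₀ S.f _).symm inferInstance
    | n + 2 =>
      have := isZero_double_X S.f ComplexShape.down_rel_one_zero (n + 2)
        (by omega) (by omega)
      exact Projective.of_iso this.isoZero.symm inferInstance
  π := (ChainComplex.toSingle₀Equiv _ _).symm
    ⟨(doubleXIso₁ S.f _ one_ne_zero).hom ≫ S.g, by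
      rw [double_d _ _ one_ne_zero]; simp⟩
  quasiIso := ⟨fun n => by
    cases n with
    | zero =>
      rw [ChainComplex.quasiIsoAt₀_iff, ShortComplex.quasiIso_iff_of_zeros']
      · refine (ShortComplex.exact_and_epi_g_iff_of_iso ?_).2 ⟨hS.exact, hS.epi_g⟩
        refine ShortComplex.isoMk (doubleXIso₀ S.f ComplexShape.down_rel_one_zero)
          (doubleXIso₁ S.f ComplexShape.down_rel_one_zero one_ne_zero) (Iso.refl _) ?_ ?_
        · have h : (doubleXIso₀ S.f ComplexShape.down_rel_one_zero).hom ≫ S.f =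
              (double S.f ComplexShape.down_rel_one_zero).d 1 0 ≫
                (doubleXIso₁ S.f ComplexShape.down_rel_one_zero one_ne_zero).hom := by
            simp [double_d _ _ one_ne_zero]
          exact h
        · simp only [HomologicalComplex.shortComplexFunctor'_map_τ₂,
            ChainComplex.toSingle₀Equiv_symm_apply_f_zero, Iso.refl_hom]
          exact (Category.comp_id _).symm
      · exact (double S.f ComplexShape.down_rel_one_zero).shape 0 0 (by simp)
      all_goals rfl
    | succ n =>
      rw [quasiIsoAt_iff_exactAt']
      · refine ChainComplex.exactAt_succ_of_mono ?_ (fun n => ?_) n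
        · have := hS.mono_f
          rw [double_d _ _ one_ne_zero]
          infer_instance
        · exact isZero_double_X _ _ _ (by omega) (by omega)
      · apply ChainComplex.exactAt_succ_single_obj⟩

/-- If the first and middle terms of a short exact sequence are projective and an additive functor
preserves the injectivity of its first map, then the higher left derived functors vanish on its
last term. -/
lemma isZero_leftDerived_succ {S : ShortComplex C} (hS : S.ShortExact)
    [Projective S.X₁] [Projective S.X₂] [HasProjectiveResolutions C] (F : C ⥤ D) [F.Additive]
    [Mono (F.map S.f)] (n : ℕ) : IsZero ((F.leftDerived (n + 1)).obj S.X₃) := by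
  refine IsZero.of_iso ?_ (hS.projectiveResolution.isoLeftDerivedObj F (n + 1))
  refine (exactAt_iff_isZero_homology _ _).mp (ChainComplex.exactAt_succ_of_mono ?_ (fun n => ?_) n)
  · change Mono (F.map ((double S.f ComplexShape.down_rel_one_zero).d 1 0))
    rw [double_d _ _ one_ne_zero, F.map_comp, F.map_comp]
    infer_instance
  · exact F.map_isZero (isZero_double_X S.f ComplexShape.down_rel_one_zero _ (by omega) (by omega))

end CategoryTheory.ShortComplex.ShortExact

end Complexes

section Modules

open Limits

variable {R : Type u} [CommRing R] {A B N : Type u} [AddCommGroup A] [Module R A] [AddCommGroup B]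
  [Module R B] [AddCommGroup N] [Module R N] {f : A →ₗ[R] B} {g : B →ₗ[R] N}

/-- The short complex of `R`-modules given by two composable linear maps. -/
abbrev shortComplexOfExact (hfg : Function.Exact f g) : ShortComplex (ModuleCat.{u} R) :=
  ShortComplex.mk (ModuleCat.ofHom f) (ModuleCat.ofHom g) (by
    ext x; exact hfg.apply_apply_eq_zero x)

lemma shortExact_shortComplexOfExact (hf : Function.Injective f) (hg : Function.Surjective g)
    (hfg : Function.Exact f g) : (shortComplexOfExact hfg).ShortExact where
  exact := (ShortComplex.ShortExact.moduleCat_exact_iff_function_exact _).mpr hfg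
  mono_f := (ModuleCat.mono_iff_injective _).mpr hf
  epi_g := (ModuleCat.epi_iff_surjective _).mpr hg

/-- A projective resolution of length one which remains exact after tensoring with `M` shows that
`Tor` vanishes in positive degrees. -/
lemma torVanishes_of_exact [Module.Projective R A] [Module.Projective R B] (M : Type u)
    [AddCommGroup M] [Module R M] (hf : Function.Injective f) (hg : Function.Surjective g)
    (hfg : Function.Exact f g) (hM : Function.Injective (f.lTensor M)) : TorVanishes R M N := by
  intro i hi
  obtain ⟨n, rfl⟩ : ∃ n, i = n + 1 := ⟨i - 1, by omega⟩
  have hS := shortExact_shortComplexOfExact hf hg hfg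
  have h₁ : Projective (shortComplexOfExact hfg).X₁ :=
    (IsProjective.iff_projective (R := R) A).mp inferInstance
  have h₂ : Projective (shortComplexOfExact hfg).X₂ :=
    (IsProjective.iff_projective (R := R) B).mp inferInstance
  have : Mono (((MonoidalCategory.tensoringLeft (ModuleCat.{u} R)).obj (ModuleCat.of R M)).map
      (shortComplexOfExact hfg).f) := (ModuleCat.mono_iff_injective _).mpr hM
  exact hS.isZero_leftDerived_succ
    ((MonoidalCategory.tensoringLeft (ModuleCat.{u} R)).obj (ModuleCat.of R M)) n

lemma projectiveDimension_eq_one_of_exact [Module.Projective R A] [Module.Projective R B]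
    (hf : Function.Injective f) (hg : Function.Surjective g)
    (hfg : Function.Exact f g) (hN : ¬ Module.Projective R N) :
    projectiveDimension (ModuleCat.of R N) = 1 := by
  have hS := shortExact_shortComplexOfExact hf hg hfg
  have h₁ : Projective (shortComplexOfExact hfg).X₁ :=
    (IsProjective.iff_projective (R := R) A).mp inferInstance
  have h₂ : Projective (shortComplexOfExact hfg).X₂ :=
    (IsProjective.iff_projective (R := R) B).mp inferInstance
  refine le_antisymm ?_ ?_
  · refine (projectiveDimension_le_iff _ 1).mpr ((hS.hasProjectiveDimensionLT_X₃_iff 0 h₂).mpr ?_)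
    exact projective_iff_hasProjectiveDimensionLT_one.mp h₁
  · refine (projectiveDimension_ge_iff _ 1).mpr fun h => hN ?_
    exact (IsProjective.iff_projective (R := R) N).mpr
      (projective_iff_hasProjectiveDimensionLT_one.mpr h)

end Modules
end ShortResolutions

/-! ### Transposes of cyclic modules over local rings -/

section Transpose

open IsLocalRing

variable {R : Type u} [CommRing R] {ι : Type} [Fintype ι]

/-- The cokernel of the map `R → Rᵐ` given by the column `v`. It is a transpose of `R / (v)`. -/
abbrev columnCokernel (v : ι → R) : Type u := (ι → R) ⧸ Submodule.span R {v}

lemma isAuslanderTranspose_exists (v : ι → R) :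
    ∃ (N : Type u) (_ : AddCommGroup N) (_ : Module R N),
      IsAuslanderTranspose R (R ⧸ Ideal.span (Set.range v)) N := by
  refine ⟨Module.Dual R (ι → R) ⧸ LinearMap.range (Fintype.linearCombination R v).dualMap,
    inferInstance, inferInstance, ι → R, R, inferInstance, inferInstance, inferInstance,
    inferInstance, Fintype.linearCombination R v, (Ideal.span (Set.range v)).mkQ, inferInstance,
    inferInstance, inferInstance, inferInstance, ?_, Submodule.mkQ_surjective _,
    ⟨LinearEquiv.refl R _⟩⟩
  rw [LinearMap.exact_iff, Submodule.ker_mkQ, Fintype.range_linearCombination]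

/-- Splitting data for a presentation `f : P₁ → P₀` of `R / (v)` over a local ring: up to
isomorphism, `f` is the direct sum of the row `v : Rᵐ → R`, of an identity map `K → K` and of a map
`G → 0`. Here `Φ` is the projection of `P₁` to `Rᵐ × K`, and `h` is the projection of `P₀` to `R`
with kernel `K`. -/
lemma exists_splitting_of_presentation [IsLocalRing R] {v : ι → R} (hv : ∀ i, v i ∈ maximalIdeal R)
    (hmin : ∀ c : ι → R, ∑ i, c i * v i = 0 → ∀ i, c i ∈ maximalIdeal R)
    {P₁ P₀ : Type u} [AddCommGroup P₁] [Module R P₁] [AddCommGroup P₀] [Module R P₀]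
    [Module.Projective R P₁] [Module.Finite R P₀] [Module.Projective R P₀]
    {f : P₁ →ₗ[R] P₀} {g : P₀ →ₗ[R] R ⧸ Ideal.span (Set.range v)} (hfg : Function.Exact f g)
    (hg : Function.Surjective g) :
    ∃ (h : P₀ →ₗ[R] R) (e : P₀) (Φ : P₁ →ₗ[R] (ι → R) × LinearMap.ker h)
      (s : (ι → R) × LinearMap.ker h →ₗ[R] P₁), h e = 1 ∧ (∀ x, Φ (s x) = x) ∧
      ∀ p, f p = (∑ i, (Φ p).1 i * v i) • e + (Φ p).2 := by
  classical
  have hIm : Ideal.span (Set.range v) ≤ maximalIdeal R :=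
    Ideal.span_le.mpr (by rintro _ ⟨i, rfl⟩; exact hv i)
  obtain ⟨h, hh⟩ := Module.projective_lifting_property (Ideal.span (Set.range v)).mkQ g
    (Submodule.mkQ_surjective _)
  have hgh : ∀ p, g p = Submodule.Quotient.mk (h p) := fun p => by rw [← hh]; rfl
  obtain ⟨e, he⟩ : ∃ e, h e = 1 := by
    obtain ⟨e, he⟩ := hg (Submodule.Quotient.mk 1)
    rw [hgh, Submodule.Quotient.eq] at he
    have hu : IsUnit (h e) := by
      by_contra hne
      have h1 : (1 : R) ∈ maximalIdeal R := by
        have := Ideal.sub_mem _ ((mem_maximalIdeal _).mpr hne) (hIm he)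
        rwa [sub_sub_cancel] at this
      exact (Ideal.ne_top_iff_one _).mp (maximalIdeal.isMaximal R).ne_top h1
    obtain ⟨a, ha⟩ := hu.exists_left_inv
    exact ⟨a • e, by rw [map_smul, smul_eq_mul, ha]⟩
  -- `ρ` is the projection onto the kernel of `h` along `e`
  let ρ : P₀ →ₗ[R] LinearMap.ker h :=
    LinearMap.codRestrict _ (LinearMap.id - h.smulRight e) fun p => by
      simp [LinearMap.mem_ker, he]
  have hρ : ∀ p, (ρ p : P₀) = p - h p • e := fun p => rfl
  have hρs : ρ ∘ₗ (LinearMap.ker h).subtype = LinearMap.id := by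
    ext k
    simp [hρ, LinearMap.mem_ker.mp k.2]
  have hKfin : Module.Finite R (LinearMap.ker h) := Module.Finite.of_surjective ρ fun k =>
    ⟨k, LinearMap.congr_fun hρs k⟩
  have hKproj : Module.Projective R (LinearMap.ker h) := Module.Projective.of_split _ _ hρs
  have hrange : LinearMap.range (Fintype.linearCombination R v) = Ideal.span (Set.range v) :=
    Fintype.range_linearCombination R v
  have hmemI : ∀ p, h (f p) ∈ Ideal.span (Set.range v) := fun p => by
    rw [← Submodule.Quotient.mk_eq_zero, ← hgh]; exact hfg.apply_apply_eq_zero p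
  obtain ⟨ψ, hψ⟩ : ∃ ψ : P₁ →ₗ[R] (ι → R), ∀ p, ∑ i, ψ p i * v i = h (f p) := by
    obtain ⟨ψ, hψ⟩ := Module.projective_lifting_property
      (Fintype.linearCombination R v).rangeRestrict
      (LinearMap.codRestrict (LinearMap.range (Fintype.linearCombination R v)) (h ∘ₗ f)
        fun p => by rw [hrange]; exact hmemI p) (LinearMap.surjective_rangeRestrict _)
    refine ⟨ψ, fun p => ?_⟩
    have := congrArg Subtype.val (LinearMap.congr_fun hψ p)
    simpa [Fintype.linearCombination_apply] using this
  let Φ : P₁ →ₗ[R] (ι → R) × LinearMap.ker h := ψ.prod (ρ ∘ₗ f)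
  -- by Nakayama, since two lifts of an element of `(v)` to `Rᵐ` differ by an element of `𝔪 Rᵐ`
  have hΦ : Function.Surjective Φ := by
    rw [← LinearMap.range_eq_top, eq_top_iff]
    refine Submodule.le_of_le_smul_of_le_jacobson_bot (I := maximalIdeal R)
      Module.Finite.fg_top (maximalIdeal_le_jacobson _) ?_
    rintro ⟨u, k⟩ -
    obtain ⟨p, hp⟩ : ∃ p, f p = (∑ i, u i * v i) • e + k := by
      refine (hfg _).mp ?_
      rw [hgh, map_add, map_smul, he, LinearMap.mem_ker.mp k.2, Submodule.Quotient.mk_eq_zero,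
        add_zero, smul_eq_mul, mul_one, ← hrange]
      exact ⟨u, by simp [Fintype.linearCombination_apply]⟩
    have hhp : h (f p) = ∑ i, u i * v i := by
      rw [hp, map_add, map_smul, he, LinearMap.mem_ker.mp k.2, add_zero, smul_eq_mul, mul_one]
    have hd : ∀ i, (u - ψ p) i ∈ maximalIdeal R := hmin _ (by
      simp only [Pi.sub_apply, sub_mul, Finset.sum_sub_distrib]
      rw [hψ, hhp, sub_self])
    have hsplit : (u, k) = Φ p + (u - ψ p, 0) := by
      refine Prod.ext (by simp [Φ]) (Subtype.ext ?_)
      change (k : P₀) = f p - h (f p) • e + 0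
      rw [hhp, hp]
      abel
    rw [hsplit]
    refine Submodule.add_mem_sup ⟨p, rfl⟩ ?_
    have hsum : ((u - ψ p, 0) : (ι → R) × LinearMap.ker h) =
        ∑ i, (u - ψ p) i • ((Pi.single i 1, 0) : (ι → R) × LinearMap.ker h) := by
      refine Prod.ext ?_ ?_
      · rw [Prod.fst_sum]
        simpa using (pi_eq_sum_univ' (u - ψ p))
      · rw [Prod.snd_sum]; simp
    rw [hsum]
    exact Submodule.sum_mem _ fun i _ => Submodule.smul_mem_smul (hd i) trivial
  obtain ⟨s, hs⟩ := Module.projective_lifting_property Φ LinearMap.id hΦ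
  refine ⟨h, e, Φ, s, he, fun x => LinearMap.congr_fun hs x, fun p => ?_⟩
  simp [Φ, hψ, hρ]

/-- Over a local ring, if the entries of `v` minimally generate the ideal `(v)`, every transpose of
`R / (v)` is the sum of the cokernel of the column `v` and a free module. -/
theorem IsAuslanderTranspose.exists_linearEquiv_columnCokernel_prod [IsLocalRing R] {v : ι → R}
    (hv : ∀ i, v i ∈ maximalIdeal R)
    (hmin : ∀ c : ι → R, ∑ i, c i * v i = 0 → ∀ i, c i ∈ maximalIdeal R)
    {N : Type u} [AddCommGroup N] [Module R N]
    (hN : IsAuslanderTranspose R (R ⧸ Ideal.span (Set.range v)) N) :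
    ∃ (G : Type u) (_ : AddCommGroup G) (_ : Module R G), Module.Finite R G ∧ Module.Free R G ∧
      Nonempty (N ≃ₗ[R] columnCokernel v × G) := by
  classical
  obtain ⟨P₁, P₀, _, _, _, _, f, g, _, _, _, _, hfg, hg, ⟨eN⟩⟩ := hN
  obtain ⟨h, e, Φ, s, he, hs, hf⟩ := exists_splitting_of_presentation hv hmin hfg hg
  have hsub : ∀ p, p - s (Φ p) ∈ LinearMap.ker Φ := fun p => by
    rw [LinearMap.mem_ker, map_sub, hs, sub_self]
  let τ : P₁ →ₗ[R] LinearMap.ker Φ := LinearMap.codRestrict _ (LinearMap.id - s ∘ₗ Φ) hsub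
  have hτ : ∀ p, (τ p : P₁) = p - s (Φ p) := fun p => rfl
  have hτs : τ ∘ₗ (LinearMap.ker Φ).subtype = LinearMap.id := by
    ext p
    simp [hτ, LinearMap.mem_ker.mp p.2]
  have hKfin : Module.Finite R (LinearMap.ker Φ) := Module.Finite.of_surjective τ fun k =>
    ⟨k, LinearMap.congr_fun hτs k⟩
  have hKproj : Module.Projective R (LinearMap.ker Φ) := Module.Projective.of_split _ _ hτs
  have hKfree : Module.Free R (LinearMap.ker Φ) := Module.free_of_flat_of_isLocalRing
  refine ⟨Module.Dual R (LinearMap.ker Φ), inferInstance, inferInstance, inferInstance,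
    inferInstance, ?_⟩
  -- restriction of functionals on `P₁` to the summands `Rᵐ` and `ker Φ`
  let θ : Module.Dual R P₁ →ₗ[R] (ι → R) :=
    LinearMap.pi fun i => LinearMap.applyₗ (s (Pi.single i 1, 0))
  have hθ : ∀ l i, θ l i = l (s (Pi.single i 1, 0)) := fun l i => rfl
  let Θ : Module.Dual R P₁ →ₗ[R] columnCokernel v × Module.Dual R (LinearMap.ker Φ) :=
    ((Submodule.mkQ _) ∘ₗ θ).prod (LinearMap.ker Φ).subtype.dualMap
  have hdecomp : ∀ (l : Module.Dual R P₁) (p : P₁),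
      l p = ∑ i, (Φ p).1 i * θ l i + l (s (0, (Φ p).2)) + l (τ p) := fun l p => by
    have h1 : s (Φ p) = ∑ i, (Φ p).1 i • s (Pi.single i 1, 0) + s (0, (Φ p).2) := by
      simp only [← map_smul, ← map_sum, ← map_add]
      congr 1
      refine Prod.ext ?_ ?_
      · simp only [Prod.fst_add, Prod.fst_sum, Prod.smul_fst, add_zero]
        exact pi_eq_sum_univ' _
      · simp [Prod.snd_sum]
    calc l p = l (s (Φ p)) + l (τ p) := by rw [hτ, ← map_add]; congr 1; abel
      _ = _ := by rw [h1]; simp [hθ]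
  have hΘsurj : Function.Surjective Θ := by
    rintro ⟨u, γ⟩
    obtain ⟨u, rfl⟩ := Submodule.mkQ_surjective _ u
    refine ⟨(Fintype.linearCombination R u) ∘ₗ LinearMap.fst R _ _ ∘ₗ Φ + γ ∘ₗ τ, ?_⟩
    have hτ0 : ∀ x, τ (s x) = 0 := fun x => Subtype.ext (by rw [hτ, hs]; simp)
    refine Prod.ext ?_ ?_
    · change Submodule.mkQ _ (θ _) = _
      congr 1
      ext i
      rw [hθ]
      simp [hs, hτ0, Fintype.linearCombination_apply, Pi.single_apply]
    · ext p
      change (Fintype.linearCombination R u) (Φ p).1 + γ (τ p) = γ p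
      have h2 : τ p = p := LinearMap.congr_fun hτs p
      rw [h2, LinearMap.mem_ker.mp p.2]
      simp
  have hΘker : LinearMap.ker Θ = LinearMap.range f.dualMap := by
    ext l
    have hmem : l ∈ LinearMap.ker Θ ↔
        θ l ∈ Submodule.span R {v} ∧ ∀ p ∈ LinearMap.ker Φ, l p = 0 := by
      rw [LinearMap.mem_ker, Prod.ext_iff]
      refine and_congr (Submodule.Quotient.mk_eq_zero _) ?_
      rw [LinearMap.ext_iff]
      exact ⟨fun h p hp => h ⟨p, hp⟩, fun h p => h p p.2⟩
    rw [hmem, Submodule.mem_span_singleton, LinearMap.mem_range]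
    constructor
    · rintro ⟨⟨t, ht⟩, hl⟩
      refine ⟨t • h + l ∘ₗ s ∘ₗ LinearMap.inr R _ _ ∘ₗ
        LinearMap.codRestrict _ (LinearMap.id - h.smulRight e) (fun p => by
          simp [LinearMap.mem_ker, he]), ?_⟩
      ext p
      rw [hdecomp l p, hl _ (τ p).2, ← ht]
      have hhf : h (f p) = ∑ i, (Φ p).1 i * v i := by
        rw [hf, map_add, map_smul, he, LinearMap.mem_ker.mp (Φ p).2.2]; simp
      have hk : LinearMap.codRestrict (LinearMap.ker h) (LinearMap.id - h.smulRight e) (fun p => by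
          simp [LinearMap.mem_ker, he]) (f p) = (Φ p).2 := by
        refine Subtype.ext ?_
        change f p - h (f p) • e = (Φ p).2
        rw [hhf, hf]
        abel
      rw [LinearMap.dualMap_apply]
      simp only [LinearMap.add_apply, LinearMap.smul_apply,
        LinearMap.comp_apply, hk, hhf, LinearMap.inr_apply, smul_eq_mul, add_zero,
        Pi.smul_apply, Finset.mul_sum]
      congr 1
      exact Finset.sum_congr rfl fun i _ => by ring
    · rintro ⟨μ, rfl⟩
      refine ⟨⟨μ e, ?_⟩, fun p hp => ?_⟩
      · ext i
        rw [hθ, LinearMap.dualMap_apply, hf, hs]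
        simp [Pi.single_apply, mul_comm]
      · rw [LinearMap.dualMap_apply, hf, LinearMap.mem_ker.mp hp]
        simp
  exact ⟨eN ≪≫ₗ Submodule.quotEquivOfEq _ _ hΘker.symm ≪≫ₗ Θ.quotKerEquivOfSurjective hΘsurj⟩

end Transpose

/-! ### Ideals of variables in the hypersurface ring -/

section HypersurfaceRing

open IsLocalRing RingTheory.Sequence

variable (k : Type u) [Field k]

/-- The ideal of `k⟦x, y, z, w⟧ / (xy)` generated by the variables with indices in `s`. -/
noncomputable def exVarIdeal (s : Finset (Fin 4)) : Ideal (ExRing k) :=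
  Ideal.span (exVar k '' s)

variable {k}

lemma exVar_zero_mul_exVar_one : exVar k 0 * exVar k 1 = 0 := by
  rw [← map_mul, Ideal.Quotient.eq_zero_iff_mem]
  exact Ideal.mem_span_singleton_self _

lemma exVar_mem_exVarIdeal {s : Finset (Fin 4)} {i : Fin 4} (hi : i ∈ s) :
    exVar k i ∈ exVarIdeal k s :=
  Ideal.subset_span ⟨i, hi, rfl⟩

lemma exVarIdeal_mono {s t : Finset (Fin 4)} (h : s ⊆ t) : exVarIdeal k s ≤ exVarIdeal k t :=
  Ideal.span_mono (Set.image_mono (by exact_mod_cast h))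

lemma exVarIdeal_singleton (i : Fin 4) : exVarIdeal k {i} = Ideal.span {exVar k i} := by
  simp [exVarIdeal]

lemma mem_exVarIdeal_insert {s : Finset (Fin 4)} {i : Fin 4} {r : ExRing k} :
    r ∈ exVarIdeal k (insert i s) ↔ ∃ a, ∃ b ∈ exVarIdeal k s, r = a * exVar k i + b := by
  rw [exVarIdeal, Finset.coe_insert, Set.image_insert_eq, Ideal.mem_span_insert]
  rfl

lemma exVarIdeal_eq_map (s : Finset (Fin 4)) :
    exVarIdeal k s = (Ideal.span ((MvPowerSeries.X : Fin 4 → MvPowerSeries (Fin 4) k) '' s)).map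
      (Ideal.Quotient.mk _) := by
  rw [Ideal.map_span, Set.image_image]
  rfl

lemma span_X_mul_X_le_span_X_image {s : Finset (Fin 4)} (hs : 0 ∈ s ∨ 1 ∈ s) :
    Ideal.span {(MvPowerSeries.X 0 * MvPowerSeries.X 1 : MvPowerSeries (Fin 4) k)} ≤
      Ideal.span ((MvPowerSeries.X : Fin 4 → MvPowerSeries (Fin 4) k) '' s) := by
  rw [Ideal.span_singleton_le_iff_mem]
  rcases hs with h | h
  · exact Ideal.mul_mem_right _ _ (Ideal.subset_span ⟨0, h, rfl⟩)
  · exact Ideal.mul_mem_left _ _ (Ideal.subset_span ⟨1, h, rfl⟩)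

/-- The ideal generated by a set of variables containing `x` or `y` is prime. -/
lemma isPrime_exVarIdeal {s : Finset (Fin 4)} (hs : 0 ∈ s ∨ 1 ∈ s) : (exVarIdeal k s).IsPrime := by
  have := MvPowerSeries.isPrime_span_X_image (A := k) s
  rw [exVarIdeal_eq_map]
  refine Ideal.map_isPrime_of_surjective Ideal.Quotient.mk_surjective ?_
  rw [Ideal.mk_ker]
  exact span_X_mul_X_le_span_X_image hs

lemma exVar_notMem_exVarIdeal {s : Finset (Fin 4)} (hs : 0 ∈ s ∨ 1 ∈ s) {i : Fin 4} (hi : i ∉ s) :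
    exVar k i ∉ exVarIdeal k s := by
  rw [exVarIdeal_eq_map, ← Ideal.mem_comap,
    Ideal.comap_map_of_surjective' _ Ideal.Quotient.mk_surjective, Ideal.mk_ker,
    sup_eq_left.mpr (span_X_mul_X_le_span_X_image hs), MvPowerSeries.mem_span_X_image_iff]
  intro h
  have := h (Finsupp.single i 1) fun j hj => Finsupp.single_eq_of_ne fun e => hi (e ▸ hj)
  simp at this

lemma mem_exVarIdeal_of_exVar_mul_mem {s : Finset (Fin 4)} (hs : 0 ∈ s ∨ 1 ∈ s) {i : Fin 4}
    (hi : i ∉ s) {r : ExRing k} (h : exVar k i * r ∈ exVarIdeal k s) : r ∈ exVarIdeal k s :=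
  ((isPrime_exVarIdeal hs).mem_or_mem h).resolve_left (exVar_notMem_exVarIdeal hs hi)

/-- Without `x` and `y` among the generators, the ideal of a set of variables is an intersection of
two prime ideals. -/
lemma mem_exVarIdeal_of_mem_insert {s : Finset (Fin 4)} (hs : 0 ∉ s) {r : ExRing k}
    (h0 : r ∈ exVarIdeal k (insert 0 s)) (h1 : r ∈ exVarIdeal k (insert 1 s)) :
    r ∈ exVarIdeal k s := by
  obtain ⟨a, b, hb, rfl⟩ := mem_exVarIdeal_insert.mp h0
  have ha : a ∈ exVarIdeal k (insert 1 s) := by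
    refine mem_exVarIdeal_of_exVar_mul_mem (i := 0) (by simp) (by simpa using hs) ?_
    rw [mul_comm (exVar k 0) a]
    exact (Ideal.add_mem_iff_left _ (exVarIdeal_mono (Finset.subset_insert _ _) hb)).mp h1
  obtain ⟨c, d, hd, rfl⟩ := mem_exVarIdeal_insert.mp ha
  have : (c * exVar k 1 + d) * exVar k 0 + b = d * exVar k 0 + b := by
    linear_combination c * exVar_zero_mul_exVar_one (k := k)
  rw [this]
  exact Ideal.add_mem _ (Ideal.mul_mem_right _ _ hd) hb

lemma mem_exVarIdeal_of_exVar_mul_mem' {s : Finset (Fin 4)} {i : Fin 4} (hi : i ∉ s)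
    (hi0 : i ≠ 0) (hi1 : i ≠ 1) {r : ExRing k} (h : exVar k i * r ∈ exVarIdeal k s) :
    r ∈ exVarIdeal k s := by
  by_cases hs : 0 ∈ s ∨ 1 ∈ s
  · exact mem_exVarIdeal_of_exVar_mul_mem hs hi h
  · push Not at hs
    refine mem_exVarIdeal_of_mem_insert hs.1 ?_ ?_
    · exact mem_exVarIdeal_of_exVar_mul_mem (i := i) (by simp) (by simp [hi, hi0])
        (exVarIdeal_mono (Finset.subset_insert _ _) h)
    · exact mem_exVarIdeal_of_exVar_mul_mem (i := i) (by simp) (by simp [hi, hi1])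
        (exVarIdeal_mono (Finset.subset_insert _ _) h)

lemma eq_zero_of_exVar_mul_eq_zero {i : Fin 4} (hi0 : i ≠ 0) (hi1 : i ≠ 1) {r : ExRing k}
    (h : exVar k i * r = 0) : r = 0 := by
  have := mem_exVarIdeal_of_exVar_mul_mem' (s := ∅) (k := k) (i := i) (r := r) (by simp) hi0 hi1
    (by rw [h]; exact Ideal.zero_mem _)
  simpa [exVarIdeal] using this

lemma exVar_one_mul_eq_zero_iff {r : ExRing k} :
    exVar k 1 * r = 0 ↔ r ∈ exVarIdeal k {0} := by
  constructor
  · intro h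
    exact mem_exVarIdeal_of_exVar_mul_mem (i := 1) (by simp) (by simp)
      (by rw [h]; exact Ideal.zero_mem _)
  · rw [exVarIdeal_singleton, Ideal.mem_span_singleton']
    rintro ⟨a, rfl⟩
    linear_combination a * exVar_zero_mul_exVar_one (k := k)

lemma exists_eq_exVar_one_mul {r : ExRing k} (h : exVar k 0 * r = 0) : ∃ a, r = exVar k 1 * a := by
  have : r ∈ exVarIdeal k {1} :=
    mem_exVarIdeal_of_exVar_mul_mem (i := 0) (by simp) (by simp)
      (by rw [h]; exact Ideal.zero_mem _)
  rw [exVarIdeal_singleton, Ideal.mem_span_singleton] at this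
  exact this

lemma exVar_mem_maximalIdeal (i : Fin 4) : exVar k i ∈ maximalIdeal (ExRing k) := by
  rw [← map_maximalIdeal_quotient_mk, MvPowerSeries.maximalIdeal_eq_span_X]
  exact Ideal.mem_map_of_mem _ (Ideal.subset_span ⟨i, rfl⟩)

lemma exPrime_eq : exPrime k = exVarIdeal k {1, 2, 3} := by
  simp [exPrime, exVarIdeal, Set.image_insert_eq]

variable (k)

lemma isPrime_exPrime : (exPrime k).IsPrime := by
  rw [exPrime_eq]; exact isPrime_exVarIdeal (by simp)

theorem isCompleteIntersectionOfCodim_exRing : IsCompleteIntersectionOfCodim (ExRing k) 1 := by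
  have : IsDomain (MvPowerSeries (Fin 4) k) := NoZeroDivisors.to_isDomain _
  have hX : ∀ i, (MvPowerSeries.X i : MvPowerSeries (Fin 4) k) ∈ maximalIdeal _ := fun i => by
    rw [MvPowerSeries.maximalIdeal_eq_span_X]; exact Ideal.subset_span ⟨i, rfl⟩
  refine isCompleteIntersectionOfCodim_one_quotient_span_singleton
    (mul_ne_zero (nonZeroDivisors.ne_zero MvPowerSeries.X_mem_nonzeroDivisors)
      (nonZeroDivisors.ne_zero MvPowerSeries.X_mem_nonzeroDivisors)) ?_
  rw [pow_two]
  exact Ideal.mul_mem_mul (hX 0) (hX 1)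

theorem ringKrullDim_exRing : ringKrullDim (ExRing k) = 3 := by
  have : IsDomain (MvPowerSeries (Fin 4) k) := NoZeroDivisors.to_isDomain _
  have h := ringKrullDim_quotient_span_singleton_succ_eq_ringKrullDim_of_mem_nonZeroDivisors
    (x := (MvPowerSeries.X 0 * MvPowerSeries.X 1 : MvPowerSeries (Fin 4) k))
    (mem_nonZeroDivisors_of_ne_zero
      (mul_ne_zero (nonZeroDivisors.ne_zero MvPowerSeries.X_mem_nonzeroDivisors)
        (nonZeroDivisors.ne_zero MvPowerSeries.X_mem_nonzeroDivisors)))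
    (Ideal.mul_mem_right _ _ (by
      rw [MvPowerSeries.maximalIdeal_eq_span_X]; exact Ideal.subset_span ⟨0, rfl⟩))
  rw [MvPowerSeries.ringKrullDim_fin] at h
  have h2 : ringKrullDim (ExRing k) + 1 = 4 := h
  rw [← maximalIdeal_height_eq_ringKrullDim] at h2 ⊢
  generalize (maximalIdeal (ExRing k)).height = n at h2 ⊢
  have h3 : n + 1 = 3 + 1 := by
    have : n + 1 = 4 := WithBot.coe_injective h2
    rw [this]; norm_num
  have h4 := ENat.add_left_injective_of_ne_top ENat.one_ne_top h3
  rw [h4]; rfl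

/-- The height is read off the chain of primes `(y) ⊂ (y, z) ⊂ (y, z, w) ⊂ (x, y, z, w)`, as the
ring has dimension three. -/
theorem height_exPrime : (exPrime k).height = 2 := by
  have hprime : ∀ s : Finset (Fin 4), 1 ∈ s → (exVarIdeal k s).IsPrime := fun s hs =>
    isPrime_exVarIdeal (Or.inr hs)
  have hlt : ∀ (s : Finset (Fin 4)) (i : Fin 4), 1 ∈ s → i ∉ s →
      (exVarIdeal k s).height + 1 ≤ (exVarIdeal k (insert i s)).height := fun s i hs hi => by
    have := hprime s hs
    refine Order.add_one_le_of_lt (Ideal.height_strict_mono_of_isPrime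
      (lt_of_le_of_ne (exVarIdeal_mono (Finset.subset_insert _ _)) fun h => ?_))
    refine exVar_notMem_exVarIdeal (k := k) (Or.inr hs) hi ?_
    rw [h]
    exact exVar_mem_exVarIdeal (Finset.mem_insert_self _ _)
  have h1 := hlt {1} 2 (by simp) (by simp)
  have h2 := hlt {2, 1} 3 (by simp) (by simp)
  have h3 := hlt {3, 2, 1} 0 (by simp) (by simp)
  have h4 : (exVarIdeal k {0, 3, 2, 1}).height ≤ 3 := by
    have := hprime {0, 3, 2, 1} (by simp)
    have h := Ideal.height_le_ringKrullDim_of_isPrime (I := exVarIdeal k {0, 3, 2, 1})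
    rw [ringKrullDim_exRing] at h
    exact WithBot.coe_le_coe.mp h
  have he : exPrime k = exVarIdeal k {3, 2, 1} := by
    rw [exPrime_eq]
    congr 1
    decide
  rw [he]
  refine le_antisymm ?_ ?_
  · have h5 : (exVarIdeal k {3, 2, 1}).height + 1 ≤ 2 + 1 := (h3.trans h4).trans (by norm_num)
    exact (ENat.add_le_add_iff_right ENat.one_ne_top).mp h5
  · calc (2 : ℕ∞) = 0 + 1 + 1 := by norm_num
      _ ≤ (exVarIdeal k {1}).height + 1 + 1 := by gcongr; exact bot_le
      _ ≤ (exVarIdeal k {2, 1}).height + 1 := by gcongr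
      _ ≤ _ := h2

/-- A sequence is weakly regular on `A / J` if each member is a nonzerodivisor modulo `J` and its
predecessors. -/
lemma isWeaklyRegular_quotient {A : Type*} [CommRing A] (J : Ideal A) {rs : List A}
    (h : ∀ (i : ℕ) (hi : i < rs.length) (a : A), rs[i] * a ∈ J ⊔ Ideal.ofList (rs.take i) →
      a ∈ J ⊔ Ideal.ofList (rs.take i)) : IsWeaklyRegular (A ⧸ J) rs := by
  have key : ∀ (I : Ideal A) (a : A),
      (Submodule.Quotient.mk a : A ⧸ J) ∈ I • (⊤ : Submodule A (A ⧸ J)) ↔ a ∈ J ⊔ I := by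
    intro I a
    have h1 : I • (⊤ : Submodule A (A ⧸ J)) = Submodule.map J.mkQ I := by
      rw [← Ideal.mul_top I, ← smul_eq_mul, Submodule.map_smul'', Submodule.map_top,
        Submodule.range_mkQ, smul_eq_mul, Ideal.mul_top]
    rw [h1, ← Submodule.comap_map_mkQ]
    rfl
  refine ⟨fun i hi => ?_⟩
  rw [isSMulRegular_quotient_iff_mem_of_smul_mem]
  intro m hm
  obtain ⟨a, rfl⟩ := Submodule.Quotient.mk_surjective _ m
  rw [← Submodule.Quotient.mk_smul, key] at hm
  exact (key _ _).mpr (h i hi a hm)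

/-- The sequence `z, w, x + y` is regular: `x + y` lies outside both of the minimal primes
`(x, z, w)` and `(y, z, w)` of `(z, w)`, whose intersection is `(z, w)`. -/
lemma isWeaklyRegular_exRing :
    IsWeaklyRegular (ExRing k) [exVar k 2, exVar k 3, exVar k 0 + exVar k 1] := by
  refine ⟨fun i hi => ?_⟩
  rw [isSMulRegular_quotient_iff_mem_of_smul_mem, smul_eq_mul, Ideal.mul_top]
  intro a ha
  rw [smul_eq_mul] at ha
  match i, hi with
  | 0, _ =>
    have e : Ideal.ofList (List.take 0 [exVar k 2, exVar k 3, exVar k 0 + exVar k 1]) =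
      exVarIdeal k ∅ := by simp [exVarIdeal, Ideal.ofList]
    rw [e] at ha ⊢
    exact mem_exVarIdeal_of_exVar_mul_mem' (by simp) (by decide) (by decide) ha
  | 1, _ =>
    have e : Ideal.ofList (List.take 1 [exVar k 2, exVar k 3, exVar k 0 + exVar k 1]) =
      exVarIdeal k {2} := by simp [exVarIdeal, Ideal.ofList]
    rw [e] at ha ⊢
    exact mem_exVarIdeal_of_exVar_mul_mem' (by simp) (by decide) (by decide) ha
  | 2, _ =>
    have e : Ideal.ofList (List.take 2 [exVar k 2, exVar k 3, exVar k 0 + exVar k 1]) =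
      exVarIdeal k {2, 3} := by
      simp only [exVarIdeal, Ideal.ofList]
      congr 1
      ext
      simp [eq_comm]
    rw [e] at ha ⊢
    change (exVar k 0 + exVar k 1) * a ∈ _ at ha
    rw [add_mul] at ha
    refine mem_exVarIdeal_of_mem_insert (by simp) ?_ ?_
    · refine mem_exVarIdeal_of_exVar_mul_mem (i := 1) (by simp) (by simp) ?_
      exact (Ideal.add_mem_iff_right _
        (Ideal.mul_mem_right _ _ (exVar_mem_exVarIdeal (k := k) (i := 0) (by simp)))).mp
        (exVarIdeal_mono (Finset.subset_insert _ _) ha)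
    · refine mem_exVarIdeal_of_exVar_mul_mem (i := 0) (by simp) (by simp) ?_
      exact (Ideal.add_mem_iff_left _
        (Ideal.mul_mem_right _ _ (exVar_mem_exVarIdeal (k := k) (i := 1) (by simp)))).mp
        (exVarIdeal_mono (Finset.subset_insert _ _) ha)

lemma isWeaklyRegular_exModule :
    IsWeaklyRegular (ExModule k) [exVar k 1, exVar k 2, exVar k 3] := by
  refine isWeaklyRegular_quotient _ fun i hi a ha => ?_
  have key : ∀ (s : Finset (Fin 4)) (l : List (ExRing k)) (j : Fin 4),
      Ideal.ofList l = exVarIdeal k s → j ∉ insert 0 s →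
      exVar k j * a ∈ Ideal.span {exVar k 0} ⊔ Ideal.ofList l →
      a ∈ Ideal.span {exVar k 0} ⊔ Ideal.ofList l := by
    intro s l j hl hj h
    have e : Ideal.span {exVar k 0} ⊔ Ideal.ofList l = exVarIdeal k (insert 0 s) := by
      rw [hl, exVarIdeal, exVarIdeal, Finset.coe_insert, Set.image_insert_eq, Ideal.span_insert]
    rw [e] at h ⊢
    exact mem_exVarIdeal_of_exVar_mul_mem (by simp) hj h
  match i, hi with
  | 0, _ => exact key ∅ [] 1 (by simp [exVarIdeal, Ideal.ofList]) (by decide) ha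
  | 1, _ => exact key {1} [exVar k 1] 2 (by simp [exVarIdeal, Ideal.ofList]) (by decide) ha
  | 2, _ =>
    refine key {1, 2} [exVar k 1, exVar k 2] 3 ?_ (by decide) ha
    simp only [exVarIdeal, Ideal.ofList]
    congr 1
    ext
    simp [eq_comm]

end HypersurfaceRing

/-! ### Serre's condition -/

section SerreConditions

open IsLocalRing RingTheory.Sequence

variable {R : Type u} [CommRing R] {M : Type u} [AddCommGroup M] [Module R M]

lemma length_le_localDepth [IsLocalRing R] {rs : List R} (hrs : ∀ r ∈ rs, r ∈ maximalIdeal R)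
    (h : IsWeaklyRegular M rs) : (rs.length : ℕ∞) ≤ localDepth R M :=
  le_iSup_of_le rs (le_iSup_of_le hrs (le_iSup_of_le h le_rfl))

lemma length_le_localDepth_localizedModule {q : PrimeSpectrum R} {rs : List R}
    (hrs : ∀ r ∈ rs, r ∈ q.asIdeal) (h : IsWeaklyRegular M rs) :
    (rs.length : ℕ∞) ≤ localDepth (Localization.AtPrime q.asIdeal)
      (LocalizedModule q.asIdeal.primeCompl M) := by
  have h1 := h.of_isLocalizedModule (Localization.AtPrime q.asIdeal) q.asIdeal.primeCompl
    (LocalizedModule.mkLinearMap q.asIdeal.primeCompl M)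
  have h2 := length_le_localDepth (by
    intro r hr
    obtain ⟨a, ha, rfl⟩ := List.mem_map.mp hr
    exact (IsLocalization.AtPrime.to_map_mem_maximal_iff _ q.asIdeal a).mpr (hrs a ha)) h1
  simpa using h2

lemma satisfiesSerre_of_forall_exists {n : ℕ}
    (h : ∀ q : PrimeSpectrum R, ∃ rs : List R, (∀ r ∈ rs, r ∈ q.asIdeal) ∧ IsWeaklyRegular M rs ∧
      min (n : ℕ∞) q.asIdeal.height ≤ rs.length) : SatisfiesSerre R M n := by
  intro q _
  obtain ⟨rs, h1, h2, h3⟩ := h q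
  rw [IsLocalization.AtPrime.ringKrullDim_eq_height q.asIdeal]
  have h4 := h3.trans (length_le_localDepth_localizedModule h1 h2)
  have h5 : (n : WithBot ℕ∞) = ((n : ℕ∞) : WithBot ℕ∞) := rfl
  rw [h5, ← WithBot.coe_min]
  exact WithBot.coe_le_coe.mpr h4

lemma localDepth_le_ringKrullDim [IsLocalRing R] [IsNoetherianRing R] [Module.Finite R M]
    [Nontrivial M] : (localDepth R M : WithBot ℕ∞) ≤ ringKrullDim R := by
  have hdim : ∃ d : ℕ∞, ringKrullDim R = d :=
    ⟨(maximalIdeal R).height, maximalIdeal_height_eq_ringKrullDim.symm⟩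
  obtain ⟨d, hd⟩ := hdim
  rw [hd, WithBot.coe_le_coe]
  refine iSup_le fun rs => iSup_le fun hrs => iSup_le fun hreg => ?_
  have h1 := Module.supportDim_add_length_eq_supportDim_of_isRegular rs
    (IsRegular.of_isWeaklyRegular_of_mem_maximalIdeal M hrs hreg)
  have hnt : Nontrivial (M ⧸ Ideal.ofList rs • (⊤ : Submodule R M)) :=
    (IsRegular.of_isWeaklyRegular_of_mem_maximalIdeal M hrs hreg).quot_ofList_smul_nontrivial _
  have h2 : (0 : WithBot ℕ∞) ≤ Module.supportDim R (M ⧸ Ideal.ofList rs • (⊤ : Submodule R M)) := by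
    have := Module.supportDim_ne_bot_of_nontrivial R (M ⧸ Ideal.ofList rs • (⊤ : Submodule R M))
    generalize Module.supportDim R (M ⧸ Ideal.ofList rs • (⊤ : Submodule R M)) = e at this ⊢
    cases e with
    | bot => exact absurd rfl this
    | coe e => exact WithBot.coe_le_coe.mpr bot_le
  have h3 : ((rs.length : ℕ∞) : WithBot ℕ∞) ≤ d := by
    calc ((rs.length : ℕ∞) : WithBot ℕ∞) = 0 + (rs.length : WithBot ℕ∞) := by rw [zero_add]; rfl
      _ ≤ _ := by gcongr
      _ = Module.supportDim R M := h1
      _ ≤ ringKrullDim R := Module.supportDim_le_ringKrullDim R M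
      _ = d := hd
  exact WithBot.coe_le_coe.mp h3

lemma isMaximalCohenMacaulay_of_isWeaklyRegular [IsLocalRing R] [IsNoetherianRing R]
    [Module.Finite R M] [Nontrivial M] {rs : List R} (hrs : ∀ r ∈ rs, r ∈ maximalIdeal R)
    (h : IsWeaklyRegular M rs) (hdim : ringKrullDim R ≤ rs.length) :
    IsMaximalCohenMacaulay R M :=
  ⟨inferInstance, le_antisymm localDepth_le_ringKrullDim
    (hdim.trans (WithBot.coe_le_coe.mpr (length_le_localDepth hrs h)))⟩

lemma satisfiesSerre_of_isWeaklyRegular [IsLocalRing R] [IsNoetherianRing R]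
    [Module.Finite R M] {rs : List R} (hrs : ∀ r ∈ rs, r ∈ maximalIdeal R)
    (h : IsWeaklyRegular M rs) (hdim : ringKrullDim R ≤ rs.length) (n : ℕ) :
    SatisfiesSerre R M n :=
  satisfiesSerre_of_forall_exists fun q => by
    obtain ⟨ts, h1, h2, h3⟩ := exists_isWeaklyRegular_height_le_length hrs h hdim q
    exact ⟨ts, h1, h2, (min_le_right _ _).trans h3⟩

/-- An `R`-regular sequence of length at most two is regular on every dual module, since both
conditions can be checked value by value. -/
lemma isWeaklyRegular_dual {rs : List R} (h : IsWeaklyRegular R rs) (hlen : rs.length ≤ 2) :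
    IsWeaklyRegular (Module.Dual R M) rs := by
  have reg : ∀ a : R, IsSMulRegular R a → IsSMulRegular (Module.Dual R M) a := fun a ha φ φ' hφ =>
    LinearMap.ext fun m => ha (LinearMap.congr_fun hφ m)
  match rs, hlen with
  | [], _ => simp
  | [a], _ =>
    rw [isWeaklyRegular_singleton_iff] at h ⊢
    exact reg a h
  | [a, b], _ =>
    rw [isWeaklyRegular_cons_iff, isWeaklyRegular_singleton_iff,
      isSMulRegular_quotSMulTop_iff] at h ⊢
    obtain ⟨ha, hb⟩ := h
    refine ⟨reg a ha, fun φ ψ hφψ => ?_⟩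
    have hex : ∀ m, ∃ c, φ m = a • c := fun m => hb _ _ (LinearMap.congr_fun hφψ m)
    choose c hc using hex
    refine ⟨⟨⟨c, fun m m' => ha ?_⟩, fun r m => ha ?_⟩, LinearMap.ext hc⟩
    · change a • c (m + m') = a • (c m + c m')
      rw [← hc, smul_add, ← hc, ← hc, map_add]
    · change a • c (r • m) = a • (r • c m)
      rw [← hc, map_smul, hc, smul_comm]

/-- Over a local ring whose depth equals its dimension, reflexive modules satisfy `(S₂)`. -/
theorem satisfiesSerre_two_of_isReflexive [IsLocalRing R] [IsNoetherianRing R] {rs : List R}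
    (hrs : ∀ r ∈ rs, r ∈ maximalIdeal R) (h : IsWeaklyRegular R rs)
    (hdim : ringKrullDim R ≤ rs.length) [Module.IsReflexive R M] : SatisfiesSerre R M 2 := by
  refine satisfiesSerre_of_forall_exists fun q => ?_
  obtain ⟨ts, h1, h2, h3⟩ := exists_isWeaklyRegular_height_le_length hrs h hdim q
  refine ⟨ts.take 2, fun r hr => h1 r (List.mem_of_mem_take hr), ?_, ?_⟩
  · rw [(Module.evalEquiv R M).isWeaklyRegular_congr]
    refine isWeaklyRegular_dual ?_ (List.length_take_le _ _)
    rw [← List.take_append_drop 2 ts, isWeaklyRegular_append_iff] at h2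
    exact h2.1
  · rw [List.length_take]
    push_cast
    exact min_le_min le_rfl h3

end SerreConditions

/-! ### Reflexive modules -/

section Reflexivity

lemma exists_linearMap_apply_eq {R M M' P : Type*} [CommRing R] [AddCommGroup M] [Module R M]
    [AddCommGroup M'] [Module R M'] [AddCommGroup P] [Module R P] {π : M →ₗ[R] M'}
    (hπ : Function.Surjective π) {l : M →ₗ[R] P} (h : ∀ m, π m = 0 → l m = 0) :
    ∃ κ : M' →ₗ[R] P, ∀ m, κ (π m) = l m := by
  refine ⟨(LinearMap.ker π).liftQ l h ∘ₗ (π.quotKerEquivOfSurjective hπ).symm, fun m => ?_⟩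
  have : (π.quotKerEquivOfSurjective hπ).symm (π m) = Submodule.Quotient.mk m := by
    rw [LinearEquiv.symm_apply_eq]; rfl
  rw [LinearMap.comp_apply, LinearEquiv.coe_coe, this]
  rfl

/-- If `x` and `y` annihilate exactly each other, `R / (x)` is its own dual, by way of `y`. -/
lemma isReflexive_quotient_span_singleton {R : Type*} [CommRing R] {x y : R} (hxy : x * y = 0)
    (hx : ∀ r, x * r = 0 → y ∣ r) (hy : ∀ r, y * r = 0 → x ∣ r) :
    Module.IsReflexive R (R ⧸ Ideal.span {x}) := by
  have hmk : ∀ {r : R}, x ∣ r → (Submodule.mkQ (Ideal.span {x}) r : R ⧸ Ideal.span {x}) = 0 :=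
    fun {r} h => (Submodule.Quotient.mk_eq_zero _).mpr (Ideal.mem_span_singleton.mpr h)
  have hx0 : ∀ m : R ⧸ Ideal.span {x}, x • m = 0 := fun m => by
    obtain ⟨r, rfl⟩ := Submodule.mkQ_surjective _ m
    rw [← map_smul]
    exact hmk (Dvd.intro _ rfl)
  obtain ⟨κ, hκ⟩ := exists_linearMap_apply_eq (Submodule.mkQ_surjective (Ideal.span {x}))
    (l := LinearMap.mulLeft R y) fun r hr => by
      obtain ⟨a, rfl⟩ := Ideal.mem_span_singleton.mp ((Submodule.Quotient.mk_eq_zero _).mp hr)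
      rw [LinearMap.mulLeft_apply]
      linear_combination a * hxy
  have hgen : ∀ φ : Module.Dual R (R ⧸ Ideal.span {x}), ∃ a : R, φ = a • κ := fun φ => by
    obtain ⟨a, ha⟩ := hx (φ (Submodule.mkQ _ 1)) (by
      rw [← smul_eq_mul, ← map_smul, hx0, map_zero])
    refine ⟨a, LinearMap.ext fun m => ?_⟩
    obtain ⟨r, rfl⟩ := Submodule.mkQ_surjective _ m
    have hr : (Submodule.mkQ (Ideal.span {x}) r : R ⧸ Ideal.span {x}) = r • Submodule.mkQ _ 1 := by
      rw [← map_smul, smul_eq_mul, mul_one]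
    rw [hr, map_smul, ha, LinearMap.smul_apply, map_smul, hκ]
    simp only [LinearMap.mulLeft_apply, smul_eq_mul]
    ring
  refine ⟨⟨?_, fun ψ => ?_⟩⟩
  · rw [← LinearMap.ker_eq_bot, LinearMap.ker_eq_bot']
    intro m hm
    obtain ⟨r, rfl⟩ := Submodule.mkQ_surjective _ m
    have h := LinearMap.congr_fun hm κ
    rw [Module.Dual.eval_apply, hκ] at h
    exact hmk (hy r h)
  · obtain ⟨r, hr⟩ := hx (ψ κ) (by
      rw [← smul_eq_mul, ← map_smul]
      have : x • κ = 0 := LinearMap.ext fun m => by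
        rw [LinearMap.smul_apply, ← map_smul, hx0, map_zero, LinearMap.zero_apply]
      rw [this, map_zero])
    refine ⟨Submodule.mkQ _ r, LinearMap.ext fun φ => ?_⟩
    obtain ⟨a, rfl⟩ := hgen φ
    rw [Module.Dual.eval_apply, LinearMap.smul_apply, hκ, map_smul, hr]
    rfl

lemma isReflexive_fin_pi {R M : Type*} [CommRing R] [AddCommGroup M] [Module R M]
    [Module.IsReflexive R M] (n : ℕ) : Module.IsReflexive R (Fin n → M) := by
  induction n with
  | zero => infer_instance
  | succ n ih => exact Module.equiv (Fin.consLinearEquiv R fun _ => M)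

lemma isReflexive_fst_of_linearEquiv {R N M G : Type*} [CommRing R] [AddCommGroup N] [Module R N]
    [AddCommGroup M] [Module R M] [AddCommGroup G] [Module R G] [Module.IsReflexive R N]
    (e : N ≃ₗ[R] M × G) : Module.IsReflexive R M :=
  .of_split (e.symm.toLinearMap ∘ₗ LinearMap.inl R M G) (LinearMap.fst R M G ∘ₗ e.toLinearMap)
    (LinearMap.ext fun m => by simp)

/-- Tensor products of reflexive modules with finite free modules are reflexive. -/
lemma isReflexive_tensorProduct_of_free {R M G : Type*} [CommRing R] [AddCommGroup M] [Module R M]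
    [AddCommGroup G] [Module R G] [Module.IsReflexive R M] [Module.Finite R G] [Module.Free R G] :
    Module.IsReflexive R (M ⊗[R] G) := by
  cases subsingleton_or_nontrivial R
  · have := Module.subsingleton R (M ⊗[R] G)
    infer_instance
  have := isReflexive_fin_pi (R := R) (M := M) (Module.finrank R G)
  exact Module.equiv (((Module.finBasis R G).equivFun.lTensor M) ≪≫ₗ
    TensorProduct.piScalarRight R R M (Fin (Module.finrank R G))).symm

section Koszul

variable {R W : Type*} [CommRing R] [AddCommGroup W] [Module R W] {x y z w : R}
  {π : (Fin 3 → R) →ₗ[R] W}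

/-- The quotient of `R³` by `x R³` and the column `(y, z, w)` is reflexive, if `x` and `y`
annihilate exactly each other, `w` is a nonzerodivisor and `y, z, w` is a regular sequence modulo
`x`. The hypotheses on `x` identify `R`-valued functionals with `R / (x)`-valued ones; the quotient
is a second syzygy in the Koszul complex of `y, z, w` over `R / (x)`, and the functionals coming
from this embedding into `(R / (x))³` generate all functionals up to `w`-torsion. -/
theorem isReflexive_of_koszul (hxy : x * y = 0)
    (hx : ∀ r, x * r = 0 → y ∣ r) (hy : ∀ r, y * r = 0 → x ∣ r) (hw : ∀ r, w * r = 0 → r = 0)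
    (hyx : ∀ r, x ∣ y * r → x ∣ r) (hzx : ∀ r, x ∣ z * r → x ∣ r)
    (hzyx : ∀ r a b, z * r = a * x + b * y → ∃ a b, r = a * x + b * y)
    (hwzx : ∀ r a b, w * r = a * x + b * z → ∃ a b, r = a * x + b * z)
    (hwzyx : ∀ r a b c, w * r = a * x + b * y + c * z → ∃ a b c, r = a * x + b * y + c * z)
    (hπ : Function.Surjective π)
    (hker : ∀ u, π u = 0 ↔ ∃ t : R, ∃ u' : Fin 3 → R, u = t • ![y, z, w] + x • u') :
    Module.IsReflexive R W := by
  have hx0 : ∀ m : W, x • m = 0 := fun m => by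
    obtain ⟨u, rfl⟩ := hπ m
    rw [← map_smul, hker]
    exact ⟨0, u, by simp⟩
  have hv0 : π ![y, z, w] = 0 := (hker _).mpr ⟨1, 0, by simp⟩
  -- a row orthogonal to the column, multiplied by `y`, defines a functional on `W`
  have hrow : ∀ a : Fin 3 → R, a 0 * y + a 1 * z + a 2 * w = 0 → ∃ κ : W →ₗ[R] R, ∀ u,
      κ (π u) = y * (a 0 * u 0 + a 1 * u 1 + a 2 * u 2) := fun a ha => by
    obtain ⟨κ, hκ⟩ := exists_linearMap_apply_eq hπ
      (l := y • Fintype.linearCombination R a) fun u hu => by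
        obtain ⟨t, u', rfl⟩ := (hker u).mp hu
        simp only [LinearMap.smul_apply, Fintype.linearCombination_apply, Fin.sum_univ_three,
          Pi.add_apply, Pi.smul_apply, smul_eq_mul, Matrix.cons_val]
        linear_combination (y * t) * ha + (u' 0 * a 0 + u' 1 * a 1 + u' 2 * a 2) * hxy
    refine ⟨κ, fun u => ?_⟩
    rw [hκ]
    simp only [LinearMap.smul_apply, Fintype.linearCombination_apply, Fin.sum_univ_three,
      smul_eq_mul]
    ring
  obtain ⟨κ₀, hκ₀⟩ := hrow ![0, w, -z] (by simp; ring)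
  obtain ⟨κ₁, hκ₁⟩ := hrow ![-w, 0, y] (by simp; ring)
  obtain ⟨κ₂, hκ₂⟩ := hrow ![z, -y, 0] (by simp; ring)
  simp only [Matrix.cons_val] at hκ₀ hκ₁ hκ₂
  have hext : ∀ {φ φ' : W →ₗ[R] R}, (∀ u, φ (π u) = φ' (π u)) → φ = φ' := fun h =>
    LinearMap.ext fun m => by obtain ⟨u, rfl⟩ := hπ m; exact h u
  have hrel : y • κ₀ + z • κ₁ + w • κ₂ = 0 := hext fun u => by
    simp only [LinearMap.add_apply, LinearMap.smul_apply, hκ₀, hκ₁, hκ₂, LinearMap.zero_apply,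
      smul_eq_mul]
    ring
  have hxφ : ∀ φ : W →ₗ[R] R, x • φ = 0 := fun φ => LinearMap.ext fun m => by
    rw [LinearMap.smul_apply, ← map_smul, hx0, map_zero, LinearMap.zero_apply]
  -- up to multiplication by `w`, all functionals are combinations of the Koszul functionals
  have hgen : ∀ φ : W →ₗ[R] R, ∃ a b : R, w • φ = a • κ₀ + b • κ₁ := fun φ => by
    have hval : ∀ i, ∃ p, φ (π (Pi.single i 1)) = y * p := fun i => hx _ (by
      have := LinearMap.congr_fun (hxφ φ) (π (Pi.single i 1))
      simpa using this)
    choose p hp using hval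
    have hφ : ∀ u, φ (π u) = u 0 * (y * p 0) + u 1 * (y * p 1) + u 2 * (y * p 2) := fun u => by
      conv_lhs => rw [pi_eq_sum_univ' u]
      simp only [Fin.sum_univ_three, map_add, map_smul, smul_eq_mul, hp]
    have h0 := hφ ![y, z, w]
    rw [hv0, map_zero] at h0
    simp only [Matrix.cons_val] at h0
    refine ⟨p 1, -p 0, hext fun u => ?_⟩
    simp only [LinearMap.add_apply, LinearMap.smul_apply, hκ₀, hκ₁, hφ, smul_eq_mul]
    linear_combination -(u 2) * h0
  refine ⟨⟨?_, fun ψ => ?_⟩⟩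
  · rw [← LinearMap.ker_eq_bot, LinearMap.ker_eq_bot']
    intro m hm
    obtain ⟨u, rfl⟩ := hπ m
    have h0 := hκ₀ u
    have h2 := hκ₂ u
    rw [← Module.Dual.eval_apply, hm, LinearMap.zero_apply] at h0 h2
    obtain ⟨c₀, hc₀⟩ := hy _ h0.symm
    obtain ⟨c₂, hc₂⟩ := hy _ h2.symm
    obtain ⟨a₁, t, ht⟩ := hwzx (u 1) c₀ (u 2) (by linear_combination hc₀)
    obtain ⟨a₂, ha₂⟩ := hzx (u 2 - t * w) ⟨w * a₁ - c₀, by linear_combination w * ht - hc₀⟩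
    obtain ⟨a₀, ha₀⟩ := hzx (u 0 - t * y) ⟨c₂ + y * a₁, by linear_combination hc₂ + y * ht⟩
    rw [hker]
    refine ⟨t, ![a₀, a₁, a₂], ?_⟩
    ext i
    fin_cases i <;> simp
    · linear_combination ha₀
    · linear_combination ht
    · linear_combination ha₂
  · have hval : ∀ κ : W →ₗ[R] R, ∃ d, ψ κ = y * d := fun κ => hx _ (by
      rw [← smul_eq_mul, ← map_smul, hxφ, map_zero])
    obtain ⟨d₀, hd₀⟩ := hval κ₀
    obtain ⟨d₁, hd₁⟩ := hval κ₁
    obtain ⟨d₂, hd₂⟩ := hval κ₂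
    -- the values of `ψ` on the Koszul functionals form a Koszul cycle modulo `x`, so a boundary
    have hcyc : y * (y * d₀ + z * d₁ + w * d₂) = 0 := by
      have h := congrArg ψ hrel
      simp only [map_add, map_smul, map_zero, hd₀, hd₁, hd₂, smul_eq_mul] at h
      linear_combination h
    obtain ⟨e, he⟩ := hy _ hcyc
    obtain ⟨a₂, b₂, u₀, h₂⟩ := hwzyx d₂ e (-d₀) (-d₁) (by linear_combination he)
    obtain ⟨a₁, u₂, h₁⟩ := hzyx (d₁ + w * u₀) (e - w * a₂) (-d₀ - w * b₂)
      (by linear_combination he - w * h₂)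
    obtain ⟨a₀, h₀⟩ := hyx (d₀ + w * b₂ + z * u₂) ⟨e - w * a₂ - z * a₁, by
      linear_combination he - w * h₂ - z * h₁⟩
    have hψ : ∀ κ ∈ ({κ₀, κ₁} : Set (W →ₗ[R] R)), ψ κ = κ (π ![u₀, -b₂, u₂]) := by
      rintro κ (rfl | rfl)
      · rw [hd₀, hκ₀]
        simp only [Matrix.cons_val]
        linear_combination y * h₀ + a₀ * hxy
      · rw [hd₁, hκ₁]
        simp only [Matrix.cons_val]
        linear_combination y * h₁ + a₁ * hxy
    refine ⟨π ![u₀, -b₂, u₂], LinearMap.ext fun φ => ?_⟩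
    obtain ⟨a, b, hab⟩ := hgen φ
    rw [Module.Dual.eval_apply, ← sub_eq_zero]
    refine hw _ ?_
    have h1 := congrArg ψ hab
    have h2 := LinearMap.congr_fun hab (π ![u₀, -b₂, u₂])
    simp only [map_add, map_smul, hψ κ₀ (by simp), hψ κ₁ (by simp), LinearMap.add_apply,
      LinearMap.smul_apply, smul_eq_mul] at h1 h2
    linear_combination h2 - h1

end Koszul
end Reflexivity

/-! ### The cokernel of a column of length three -/

section ColumnCokernel

open IsLocalRing RingTheory.Sequence

variable {R : Type u} [CommRing R] {x y z w : R}

lemma mkQ_column_eq_zero_iff {u : Fin 3 → R} :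
    (Submodule.mkQ (Submodule.span R {![y, z, w]}) u : columnCokernel ![y, z, w]) = 0 ↔
      ∃ t, u 0 = t * y ∧ u 1 = t * z ∧ u 2 = t * w := by
  rw [Submodule.mkQ_apply, Submodule.Quotient.mk_eq_zero, Submodule.mem_span_singleton]
  refine exists_congr fun t => ⟨?_, fun ⟨h0, h1, h2⟩ => ?_⟩
  · rintro rfl; simp
  · ext i
    fin_cases i <;> simp [h0, h1, h2]

/-- A row orthogonal to the column induces a functional on the cokernel of the column. -/
lemma exists_dual_columnCokernel {a : Fin 3 → R} (ha : a 0 * y + a 1 * z + a 2 * w = 0) :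
    ∃ l : Module.Dual R (columnCokernel ![y, z, w]), ∀ u : Fin 3 → R,
      l (Submodule.mkQ _ u) = a 0 * u 0 + a 1 * u 1 + a 2 * u 2 := by
  obtain ⟨l, hl⟩ := exists_linearMap_apply_eq
    (Submodule.mkQ_surjective (Submodule.span R {![y, z, w]}))
    (l := Fintype.linearCombination R a) fun u hu => by
      obtain ⟨t, h0, h1, h2⟩ := mkQ_column_eq_zero_iff.mp hu
      simp only [Fintype.linearCombination_apply, Fin.sum_univ_three, smul_eq_mul, h0, h1, h2]
      linear_combination t * ha
  refine ⟨l, fun u => ?_⟩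
  rw [hl]
  simp only [Fintype.linearCombination_apply, Fin.sum_univ_three, smul_eq_mul]
  ring

lemma isTorsionFree_columnCokernel (hz : ∀ r, z * r = 0 → r = 0) (hwz : ∀ r, z ∣ w * r → z ∣ r) :
    Module.IsTorsionFree R (columnCokernel ![y, z, w]) := by
  refine ⟨fun r hr => isSMulRegular_iff_right_eq_zero_of_smul.mpr fun m hm => ?_⟩
  obtain ⟨u, rfl⟩ := Submodule.mkQ_surjective _ m
  rw [← map_smul, mkQ_column_eq_zero_iff] at hm
  obtain ⟨s, h0, h1, h2⟩ := hm
  simp only [Pi.smul_apply, smul_eq_mul] at h0 h1 h2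
  have hzw : z * u 2 = w * u 1 := hr.1 (by
    simp only
    linear_combination z * h2 - w * h1)
  obtain ⟨t, ht⟩ := hwz (u 1) ⟨u 2, hzw.symm⟩
  have hs : s = r * t := sub_eq_zero.mp (hz _ (by linear_combination -h1 + r * ht))
  refine mkQ_column_eq_zero_iff.mpr ⟨t, hr.1 ?_, by rw [ht, mul_comm], sub_eq_zero.mp (hz _ ?_)⟩
  · simp only
    linear_combination h0 + y * hs
  · linear_combination hzw + w * ht

/-- The functional `l ↦ x l(e₁) / w` on the dual of the cokernel of the column `(y, z, w)` is not
the evaluation at an element, as is seen on the functional induced by the row `(0, w, -z)`. -/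
lemma not_isReflexive_columnCokernel (hxy : x * y = 0) (hw : ∀ r, w * r = 0 → r = 0)
    (hzw : ∀ r, w ∣ z * r → w ∣ r) (hx : ∀ a b, x ≠ a * z + b * w) :
    ¬ Module.IsReflexive R (columnCokernel ![y, z, w]) := by
  intro hrefl
  let e : Fin 3 → columnCokernel ![y, z, w] := fun i => Submodule.mkQ _ (Pi.single i 1)
  have hrel : y • e 0 + z • e 1 + w • e 2 = 0 := by
    simp only [e, ← map_smul, ← map_add]
    exact mkQ_column_eq_zero_iff.mpr ⟨1, by simp⟩
  have hdiv : ∀ l : Module.Dual R (columnCokernel ![y, z, w]), ∃ t, x * l (e 1) = w * t :=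
    fun l => hzw _ ⟨-(x * l (e 2)), by
      have h := congrArg l hrel
      simp only [map_add, map_smul, map_zero, smul_eq_mul] at h
      linear_combination x * h - l (e 0) * hxy⟩
  choose φ hφ using hdiv
  let ψ : Module.Dual R (Module.Dual R (columnCokernel ![y, z, w])) :=
    { toFun := φ
      map_add' l l' := sub_eq_zero.mp (hw _ (by
        have h := hφ (l + l')
        rw [LinearMap.add_apply] at h
        linear_combination -h + hφ l + hφ l'))
      map_smul' c l := sub_eq_zero.mp (hw _ (by
        have h := hφ (c • l)
        rw [LinearMap.smul_apply, smul_eq_mul] at h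
        rw [RingHom.id_apply, smul_eq_mul]
        linear_combination -h + c * hφ l)) }
  obtain ⟨m, hm⟩ := (Module.bijective_dual_eval R (columnCokernel ![y, z, w])).2 ψ
  obtain ⟨u, rfl⟩ := Submodule.mkQ_surjective _ m
  obtain ⟨l, hl⟩ := exists_dual_columnCokernel (y := y) (z := z) (w := w) (a := ![0, w, -z])
    (by simp; ring)
  have h1 : l (Submodule.mkQ _ u) = φ l := LinearMap.congr_fun hm l
  have h2 := hφ l
  rw [hl] at h1 h2
  simp only [Matrix.cons_val, Pi.single_apply] at h1 h2
  refine hx (-u 2) (u 1) (sub_eq_zero.mp (hw _ ?_))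
  simp at h2
  linear_combination h2 - w * h1

section Resolution

variable {N G : Type u} [AddCommGroup N] [Module R N] [AddCommGroup G] [Module R G]

lemma exact_column (e : N ≃ₗ[R] columnCokernel ![y, z, w] × G) :
    Function.Exact (LinearMap.inl R (Fin 3 → R) G ∘ₗ LinearMap.toSpanSingleton R _ ![y, z, w])
      (e.symm.toLinearMap ∘ₗ (Submodule.mkQ (Submodule.span R {![y, z, w]})).prodMap .id) := by
  rintro ⟨u, g⟩
  simp only [LinearMap.comp_apply, LinearEquiv.coe_coe, LinearEquiv.map_eq_zero_iff,
    LinearMap.prodMap_apply, Prod.mk_eq_zero, LinearMap.id_apply, Set.mem_range,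
    LinearMap.inl_apply, LinearMap.toSpanSingleton_apply, Prod.mk.injEq, Submodule.mkQ_apply,
    Submodule.Quotient.mk_eq_zero, Submodule.mem_span_singleton]
  exact ⟨fun ⟨⟨t, ht⟩, hg⟩ => ⟨t, ht, hg.symm⟩, fun ⟨t, ht, hg⟩ => ⟨⟨t, ht⟩, hg.symm⟩⟩

lemma surjective_column (e : N ≃ₗ[R] columnCokernel ![y, z, w] × G) : Function.Surjective
    (e.symm.toLinearMap ∘ₗ (Submodule.mkQ (Submodule.span R {![y, z, w]})).prodMap .id) :=
  e.symm.surjective.comp ((Submodule.mkQ_surjective _).prodMap Function.surjective_id)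

/-- The second coordinate of the column map is multiplication by `z`. -/
lemma injective_lTensor_column {M : Type u} [AddCommGroup M] [Module R M] (hz : IsSMulRegular M z) :
    Function.Injective ((LinearMap.inl R (Fin 3 → R) G ∘ₗ
      LinearMap.toSpanSingleton R _ ![y, z, w]).lTensor M) := by
  refine Function.Injective.of_comp (f := (LinearMap.proj 1 ∘ₗ
    LinearMap.fst R (Fin 3 → R) G).lTensor M) ?_
  rw [← LinearMap.coe_comp, ← LinearMap.lTensor_comp]
  have h : (LinearMap.proj 1 ∘ₗ LinearMap.fst R (Fin 3 → R) G) ∘ₗ (LinearMap.inl R (Fin 3 → R) G ∘ₗ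
      LinearMap.toSpanSingleton R _ ![y, z, w]) = z • LinearMap.id := by
    ext; simp
  rw [h, LinearMap.lTensor_smul, LinearMap.lTensor_id]
  intro a b hab
  apply (TensorProduct.rid R M).injective
  apply hz
  simpa using congrArg (TensorProduct.rid R M) hab

lemma injective_column (hz : ∀ r, z * r = 0 → r = 0) :
    Function.Injective (LinearMap.inl R (Fin 3 → R) G ∘ₗ
      LinearMap.toSpanSingleton R _ ![y, z, w]) := by
  rw [← LinearMap.ker_eq_bot, LinearMap.ker_eq_bot']
  intro r hr
  have := congrFun (congrArg Prod.fst hr) 1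
  exact hz r (by simpa [mul_comm] using this)

end Resolution

/-- A module has rank as soon as it contains a free submodule with quotient killed by a
nonzerodivisor. -/
lemma hasConstantRank_of_injective {N F : Type u} [AddCommGroup N] [Module R N] [AddCommGroup F]
    [Module R F] [Module.Free R F] {f : F →ₗ[R] N} (hf : Function.Injective f) (hz : z ∈ R⁰)
    (h : ∀ n, ∃ m, f m = z • n) : HasConstantRank R N := by
  have : IsLocalizedModule R⁰ (LocalizedModule.mkLinearMap R⁰ N ∘ₗ f) := by
    refine ⟨fun s => IsLocalizedModule.map_units (LocalizedModule.mkLinearMap R⁰ N) s,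
      fun n' => ?_, fun {m₁ m₂} hm => ?_⟩
    · obtain ⟨⟨n, s⟩, hn⟩ := IsLocalizedModule.surj R⁰ (LocalizedModule.mkLinearMap R⁰ N) n'
      obtain ⟨m, hm⟩ := h n
      refine ⟨(m, ⟨z, hz⟩ * s), ?_⟩
      rw [LinearMap.comp_apply, hm, map_smul, ← hn, mul_smul]
      rfl
    · obtain ⟨c, hc⟩ := IsLocalizedModule.exists_of_eq (S := R⁰)
        (f := LocalizedModule.mkLinearMap R⁰ N) hm
      refine ⟨c, hf ?_⟩
      simp only [Submonoid.smul_def, map_smul]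
      exact hc
  exact Module.free_of_isLocalizedModule (Rₛ := Localization R⁰) R⁰
    (LocalizedModule.mkLinearMap R⁰ N ∘ₗ f)

/-- The cokernel of the column `(y, z, w)` is free, up to `z`-torsion, on the classes of the first
and third basis vectors. -/
lemma hasConstantRank_of_linearEquiv {N G : Type u} [AddCommGroup N] [Module R N] [AddCommGroup G]
    [Module R G] [Module.Free R G] (e : N ≃ₗ[R] columnCokernel ![y, z, w] × G)
    (hz : ∀ r, z * r = 0 → r = 0) : HasConstantRank R N := by
  let ι : R × R →ₗ[R] (Fin 3 → R) := LinearMap.pi ![LinearMap.fst R R R, 0, LinearMap.snd R R R]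
  have hι : ∀ a b, ι (a, b) = ![a, 0, b] := fun a b => by
    ext i; fin_cases i <;> rfl
  refine hasConstantRank_of_injective (z := z) (F := (R × R) × G)
    (f := e.symm.toLinearMap ∘ₗ (Submodule.mkQ (Submodule.span R {![y, z, w]}) ∘ₗ ι).prodMap .id)
    ?_ ?_ ?_
  · rw [LinearMap.coe_comp, LinearEquiv.coe_coe, LinearMap.coe_prodMap]
    refine e.symm.injective.comp (Function.Injective.prodMap ?_ Function.injective_id)
    rw [← LinearMap.ker_eq_bot, LinearMap.ker_eq_bot']
    rintro ⟨a, b⟩ hab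
    rw [LinearMap.comp_apply, mkQ_column_eq_zero_iff, hι] at hab
    obtain ⟨t, h0, h1, h2⟩ := hab
    simp only [Matrix.cons_val] at h0 h1 h2
    have ht := hz t (by rw [mul_comm]; exact h1.symm)
    simp [h0, h2, ht]
  · exact mem_nonZeroDivisors_iff_right.mpr fun r hr => hz r (by rwa [mul_comm])
  · intro n
    obtain ⟨⟨m, g⟩, rfl⟩ := e.symm.surjective n
    obtain ⟨u, rfl⟩ := Submodule.mkQ_surjective _ m
    refine ⟨((z * u 0 - u 1 * y, z * u 2 - u 1 * w), z • g), ?_⟩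
    rw [← map_smul]
    refine congrArg e.symm (Prod.ext ?_ rfl)
    change Submodule.mkQ _ (ι _) = z • Submodule.mkQ _ u
    rw [hι, ← map_smul, ← sub_eq_zero, ← map_sub]
    exact mkQ_column_eq_zero_iff.mpr ⟨-u 1, by simp, by simp; ring, by simp⟩

lemma surjective_one_tmul_mkQ {P : Submodule R (Fin 3 → R)} : Function.Surjective
    (TensorProduct.mk R (R ⧸ Ideal.span {x}) _ 1 ∘ₗ P.mkQ) := by
  intro m
  obtain ⟨m', rfl⟩ := (quotTensorEquivQuotSMul _ (Ideal.span {x})).symm.surjective m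
  obtain ⟨n, rfl⟩ := Submodule.Quotient.mk_surjective _ m'
  obtain ⟨u, rfl⟩ := Submodule.mkQ_surjective _ n
  exact ⟨u, by simp⟩

lemma one_tmul_mkQ_eq_zero_iff {u : Fin 3 → R} :
    (TensorProduct.mk R (R ⧸ Ideal.span {x}) (columnCokernel ![y, z, w]) 1 ∘ₗ Submodule.mkQ _) u = 0
      ↔ ∃ t : R, ∃ u' : Fin 3 → R, u = t • ![y, z, w] + x • u' := by
  rw [← (quotTensorEquivQuotSMul _ (Ideal.span {x})).map_eq_zero_iff]
  have : quotTensorEquivQuotSMul _ (Ideal.span {x}) ((TensorProduct.mk R (R ⧸ Ideal.span {x})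
      (columnCokernel ![y, z, w]) 1 ∘ₗ Submodule.mkQ _) u) =
      Submodule.Quotient.mk (Submodule.mkQ _ u) := by
    rw [← LinearEquiv.eq_symm_apply]; simp
  rw [this, Submodule.Quotient.mk_eq_zero, Submodule.ideal_span_singleton_smul,
    Submodule.mem_smul_pointwise_iff_exists]
  constructor
  · rintro ⟨m, -, hm⟩
    obtain ⟨u', rfl⟩ := Submodule.mkQ_surjective _ m
    rw [← map_smul, eq_comm, ← sub_eq_zero, ← map_sub, Submodule.mkQ_apply,
      Submodule.Quotient.mk_eq_zero, Submodule.mem_span_singleton] at hm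
    obtain ⟨t, ht⟩ := hm
    exact ⟨t, u', by rw [ht, sub_add_cancel]⟩
  · rintro ⟨t, u', rfl⟩
    refine ⟨Submodule.mkQ _ u', trivial, ?_⟩
    rw [← map_smul, eq_comm, ← sub_eq_zero, ← map_sub, Submodule.mkQ_apply,
      Submodule.Quotient.mk_eq_zero, Submodule.mem_span_singleton]
    exact ⟨t, by rw [add_sub_cancel_right]⟩

/-- If the maximal ideal is generated by `z` and `w`, and `L` contains elements with the relation
`z E₁ + w E₂ = 0` on which a functional with values in the maximal ideal takes the values
`w` and `-z`, then `L` has depth at most `1`: for `a, b` in the maximal ideal, write `a, b` in terms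
of `z, w` to get elements `n_a, n_b` with `b n_a = a n_b` on which the functional takes the values
`a` and `b`. If `a, b` is regular on `L`, then `n_a` is divisible by `a`, so `a` is a multiple of
itself by an element of the maximal ideal. -/
lemma localDepth_le_one_of_relation {A : Type u} [CommRing A] [IsLocalRing A] {L : Type u}
    [AddCommGroup L] [Module A L] [Nontrivial L] {z w : A}
    (hm : maximalIdeal A = Ideal.span {z, w}) {E₁ E₂ : L} (hE : z • E₁ + w • E₂ = 0)
    {l : L →ₗ[A] A} (h1 : l E₁ = w) (h2 : l E₂ = -z) (hl : ∀ n, l n ∈ maximalIdeal A) :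
    localDepth A L ≤ 1 := by
  refine iSup_le fun rs => iSup_le fun hrs => iSup_le fun hreg => ?_
  match rs, hrs, hreg with
  | [], _, _ => simp
  | [_], _, _ => simp
  | a :: b :: rs, hrs, hreg =>
    exfalso
    rw [isWeaklyRegular_cons_iff, isWeaklyRegular_cons_iff] at hreg
    obtain ⟨ha, hb, -⟩ := hreg
    have hmem : ∀ c ∈ a :: b :: rs, ∃ α β, α * z + β * w = c := fun c hc =>
      Ideal.mem_span_pair.mp (hm ▸ hrs c hc)
    obtain ⟨α, β, hαβ⟩ := hmem a (by simp)
    obtain ⟨γ, δ, hγδ⟩ := hmem b (by simp)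
    have hcomm : b • (β • E₁ - α • E₂) = a • (δ • E₁ - γ • E₂) := by
      rw [← sub_eq_zero]
      have : b • (β • E₁ - α • E₂) - a • (δ • E₁ - γ • E₂) =
          (γ * β - α * δ) • (z • E₁ + w • E₂) := by
        rw [← hαβ, ← hγδ]
        module
      rw [this, hE, smul_zero]
    obtain ⟨n, hn⟩ := isSMulRegular_quotSMulTop_iff.mp hb _ _ hcomm
    have hln := congrArg l hn
    simp only [map_sub, map_smul, h1, h2, smul_eq_mul] at hln
    have hunit : IsUnit (1 - l n) := by
      by_contra hu
      have := (maximalIdeal A).add_mem ((mem_maximalIdeal _).mpr hu) (hl n)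
      rw [sub_add_cancel] at this
      exact (Ideal.ne_top_iff_one _).mp (Ideal.IsPrime.ne_top inferInstance) this
    have ha0 : a = 0 := by
      rw [← hunit.mul_left_eq_zero]
      linear_combination -hαβ + hln
    obtain ⟨m, hm0⟩ := exists_ne (0 : L)
    exact hm0 (ha (by simp [ha0]))

/-- If `x ∉ q = (y, z, w)` and `xy = 0`, then `y` vanishes in `R_q`, the maximal ideal of `R_q` is
generated by `z` and `w`, and `localDepth_le_one_of_relation` applies to `N_q`. -/
lemma not_satisfiesSerre_two_of_relation {N : Type u} [AddCommGroup N] [Module R N]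
    {q : Ideal R} [hqp : q.IsPrime] (hq : q = Ideal.span {y, z, w}) (hht : 2 ≤ q.height)
    (hxy : x * y = 0) (hx : x ∉ q) (hw : ∀ r, w * r = 0 → r = 0) {e₀ e₁ e₂ : N}
    (he : y • e₀ + z • e₁ + w • e₂ = 0) {l : N →ₗ[R] R} (h1 : l e₁ = w) (h2 : l e₂ = -z)
    (hl : ∀ n, l n ∈ q) : ¬ SatisfiesSerre R N 2 := by
  intro h
  have hsupp : (⟨q, hqp⟩ : PrimeSpectrum R) ∈ Module.support R N := by
    rw [Module.mem_support_iff']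
    refine ⟨e₁, fun r hr h0 => hr ?_⟩
    have := congrArg l h0
    rw [map_smul, h1, map_zero, smul_eq_mul] at this
    rw [hw r (by rw [mul_comm]; exact this)]
    exact q.zero_mem
  have hle := h ⟨q, hqp⟩ hsupp
  have hnt : Nontrivial (LocalizedModule q.primeCompl N) := Module.mem_support_iff.mp hsupp
  let φ := LocalizedModule.mkLinearMap q.primeCompl N
  let A := Localization.AtPrime q
  let L := IsLocalizedModule.mapExtendScalars q.primeCompl φ (Algebra.linearMap R A) A l
  have hL : ∀ n, L (φ n) = algebraMap R A (l n) := fun n =>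
    IsLocalizedModule.map_apply q.primeCompl φ (Algebra.linearMap R A) l n
  have hy : algebraMap R A y = 0 :=
    (IsLocalization.map_eq_zero_iff q.primeCompl A y).mpr ⟨⟨x, hx⟩, hxy⟩
  have hmax : maximalIdeal A = Ideal.span {algebraMap R A z, algebraMap R A w} := by
    have := congrArg (Ideal.map (algebraMap R A)) hq
    rw [Localization.AtPrime.map_eq_maximalIdeal, Ideal.map_span, Set.image_insert_eq,
      Set.image_pair, hy, Ideal.span_insert_zero] at this
    exact this
  have hdepth : localDepth A (LocalizedModule q.primeCompl N) ≤ 1 := by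
    refine localDepth_le_one_of_relation hmax (E₁ := φ e₁) (E₂ := φ e₂) (l := L) ?_ ?_ ?_ ?_
    · have := congrArg φ he
      rw [map_add, map_add, map_smul, map_smul, map_smul, map_zero, ← algebraMap_smul A y,
        ← algebraMap_smul A z, ← algebraMap_smul A w, hy, zero_smul, zero_add] at this
      exact this
    · rw [hL, h1]
    · rw [hL, h2, map_neg]
    · intro n'
      obtain ⟨⟨n, s⟩, hn⟩ := IsLocalizedModule.surj q.primeCompl φ n'
      have h3 := congrArg L hn
      simp only [Submonoid.smul_def] at h3
      rw [hL, ← algebraMap_smul A, map_smul, smul_eq_mul] at h3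
      refine (Ideal.IsPrime.mem_or_mem (I := maximalIdeal A) inferInstance (h3 ▸ ?_)).resolve_left
        ((IsLocalization.AtPrime.to_map_mem_maximal_iff A q (s : R)).not.mpr s.2)
      exact (IsLocalization.AtPrime.to_map_mem_maximal_iff A q _).mpr (hl n)
  rw [IsLocalization.AtPrime.ringKrullDim_eq_height q] at hle
  have h3 := hle.trans (WithBot.coe_le_coe.mpr hdepth)
  have h4 : ((2 : ℕ∞) : WithBot ℕ∞) ≤ (1 : ℕ∞) :=
    (le_min le_rfl (WithBot.coe_le_coe.mpr hht)).trans h3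
  exact absurd (WithBot.coe_le_coe.mp h4) (by decide)

end ColumnCokernel

/-! ### The transpose of the example -/

section TransposeOfExPrime

open IsLocalRing RingTheory.Sequence

variable {k : Type u} [Field k]

lemma mem_exVarIdeal_singleton {i : Fin 4} {r : ExRing k} :
    r ∈ exVarIdeal k {i} ↔ exVar k i ∣ r := by
  rw [exVarIdeal_singleton, Ideal.mem_span_singleton]

lemma mem_exVarIdeal_pair {i j : Fin 4} {r : ExRing k} :
    r ∈ exVarIdeal k {i, j} ↔ ∃ a b, r = a * exVar k i + b * exVar k j := by
  rw [mem_exVarIdeal_insert]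
  refine exists_congr fun a => ⟨?_, ?_⟩
  · rintro ⟨b, hb, rfl⟩
    obtain ⟨c, rfl⟩ := mem_exVarIdeal_singleton.mp hb
    exact ⟨c, by ring⟩
  · rintro ⟨b, rfl⟩
    exact ⟨_, mem_exVarIdeal_singleton.mpr (Dvd.intro_left b rfl), rfl⟩

lemma mem_exVarIdeal_triple {i j l : Fin 4} {r : ExRing k} :
    r ∈ exVarIdeal k {i, j, l} ↔ ∃ a b c, r = a * exVar k i + b * exVar k j + c * exVar k l := by
  rw [mem_exVarIdeal_insert]
  refine exists_congr fun a => ⟨?_, ?_⟩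
  · rintro ⟨b, hb, rfl⟩
    obtain ⟨c, d, rfl⟩ := mem_exVarIdeal_pair.mp hb
    exact ⟨c, d, by ring⟩
  · rintro ⟨b, c, rfl⟩
    exact ⟨_, mem_exVarIdeal_pair.mpr ⟨b, c, rfl⟩, by ring⟩

lemma exVar_dvd_of_dvd_exVar_mul {i j : Fin 4} (hij : j ≠ i) (hj0 : j ≠ 0) (hj1 : j ≠ 1)
    {r : ExRing k} (h : exVar k i ∣ exVar k j * r) : exVar k i ∣ r :=
  mem_exVarIdeal_singleton.mp (mem_exVarIdeal_of_exVar_mul_mem' (by simpa using hij) hj0 hj1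
    (mem_exVarIdeal_singleton.mpr h))

lemma exVarIdeal_le_maximalIdeal (s : Finset (Fin 4)) :
    exVarIdeal k s ≤ maximalIdeal (ExRing k) :=
  Ideal.span_le.mpr (by rintro _ ⟨i, -, rfl⟩; exact exVar_mem_maximalIdeal i)

/-- The column `(y, z, w)`. -/
local notation "exColumn" k => ![exVar k 1, exVar k 2, exVar k 3]

lemma span_range_exColumn : Ideal.span (Set.range (exColumn k)) = exPrime k := by
  simp only [Matrix.range_cons, Matrix.range_empty, Set.union_empty, Set.singleton_union]

lemma exVar_zero_notMem_exPrime : exVar k 0 ∉ exPrime k := by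
  rw [exPrime_eq]; exact exVar_notMem_exVarIdeal (by simp) (by simp)

/-- The generators `y, z, w` of `𝔭` are minimal. -/
lemma mem_maximalIdeal_of_sum_mul_exColumn_eq_zero {c : Fin 3 → ExRing k}
    (hc : ∑ i, c i * (exColumn k) i = 0) (i : Fin 3) : c i ∈ maximalIdeal (ExRing k) := by
  simp only [Fin.sum_univ_three, Matrix.cons_val] at hc
  have key : ∀ (j l m : Fin 4) (a b d : ExRing k), j ∉ ({0, l, m} : Finset (Fin 4)) →
      a * exVar k j + b * exVar k l + d * exVar k m = 0 → a ∈ maximalIdeal (ExRing k) := by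
    intro j l m a b d hj h
    refine exVarIdeal_le_maximalIdeal {0, l, m} (mem_exVarIdeal_of_exVar_mul_mem (by simp) hj ?_)
    exact mem_exVarIdeal_triple.mpr ⟨0, -b, -d, by linear_combination h⟩
  fin_cases i
  · exact key 1 2 3 (c 0) (c 1) (c 2) (by decide) hc
  · exact key 2 1 3 (c 1) (c 0) (c 2) (by decide) (by linear_combination hc)
  · exact key 3 1 2 (c 2) (c 0) (c 1) (by decide) (by linear_combination hc)

variable (k) in
lemma isReflexive_exModule : Module.IsReflexive (ExRing k) (ExModule k) :=
  isReflexive_quotient_span_singleton exVar_zero_mul_exVar_one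
    (fun _ h => exists_eq_exVar_one_mul h)
    fun _ h => mem_exVarIdeal_singleton.mp (exVar_one_mul_eq_zero_iff.mp h)

variable (k) in
lemma isReflexive_exModule_tensor_columnCokernel :
    Module.IsReflexive (ExRing k) (ExModule k ⊗[ExRing k] columnCokernel (exColumn k)) :=
  isReflexive_of_koszul (x := exVar k 0) exVar_zero_mul_exVar_one
    (fun _ h => exists_eq_exVar_one_mul h)
    (fun _ h => mem_exVarIdeal_singleton.mp (exVar_one_mul_eq_zero_iff.mp h))
    (fun _ => eq_zero_of_exVar_mul_eq_zero (by decide) (by decide))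
    (fun _ h => mem_exVarIdeal_singleton.mp (mem_exVarIdeal_of_exVar_mul_mem (i := 1) (by simp)
      (by simp) (mem_exVarIdeal_singleton.mpr h)))
    (fun _ => exVar_dvd_of_dvd_exVar_mul (by decide) (by decide) (by decide))
    (fun _ a b h => mem_exVarIdeal_pair.mp (mem_exVarIdeal_of_exVar_mul_mem' (i := 2) (by decide)
      (by decide) (by decide) (mem_exVarIdeal_pair.mpr ⟨a, b, h⟩)))
    (fun _ a b h => mem_exVarIdeal_pair.mp (mem_exVarIdeal_of_exVar_mul_mem' (i := 3) (by decide)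
      (by decide) (by decide) (mem_exVarIdeal_pair.mpr ⟨a, b, h⟩)))
    (fun _ a b c h => mem_exVarIdeal_triple.mp (mem_exVarIdeal_of_exVar_mul_mem' (i := 3)
      (by decide) (by decide) (by decide) (mem_exVarIdeal_triple.mpr ⟨a, b, c, h⟩)))
    surjective_one_tmul_mkQ fun _ => one_tmul_mkQ_eq_zero_iff

section

variable {N G : Type u} [AddCommGroup N] [Module (ExRing k) N] [AddCommGroup G]
  [Module (ExRing k) G]

lemma isReflexive_exModule_tensor [Module.Finite (ExRing k) G] [Module.Free (ExRing k) G]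
    (e : N ≃ₗ[ExRing k] columnCokernel (exColumn k) × G) :
    Module.IsReflexive (ExRing k) (ExModule k ⊗[ExRing k] N) := by
  have := isReflexive_exModule k
  have := isReflexive_exModule_tensor_columnCokernel k
  have : Module.IsReflexive (ExRing k) (ExModule k ⊗[ExRing k] G) :=
    isReflexive_tensorProduct_of_free
  exact Module.equiv (e.lTensor (ExModule k) ≪≫ₗ
    TensorProduct.prodRight (ExRing k) (ExRing k) _ _ _).symm

lemma not_isReflexive_of_linearEquiv (e : N ≃ₗ[ExRing k] columnCokernel (exColumn k) × G) :
    ¬ Module.IsReflexive (ExRing k) N := by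
  intro h
  refine not_isReflexive_columnCokernel (x := exVar k 0) exVar_zero_mul_exVar_one
    (fun _ => eq_zero_of_exVar_mul_eq_zero (by decide) (by decide))
    (fun _ => exVar_dvd_of_dvd_exVar_mul (by decide) (by decide) (by decide))
    (fun a b h => exVar_zero_notMem_exPrime (k := k) ?_)
    (isReflexive_fst_of_linearEquiv e)
  rw [exPrime_eq]
  exact mem_exVarIdeal_triple.mpr ⟨0, a, b, by rw [h]; ring⟩

lemma isTorsionFree_of_linearEquiv [Module.Free (ExRing k) G]
    (e : N ≃ₗ[ExRing k] columnCokernel (exColumn k) × G) :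
    Module.IsTorsionFree (ExRing k) N := by
  have : Module.IsTorsionFree (ExRing k) (columnCokernel (exColumn k)) :=
    isTorsionFree_columnCokernel
      (fun _ => eq_zero_of_exVar_mul_eq_zero (by decide) (by decide))
      (fun _ => exVar_dvd_of_dvd_exVar_mul (by decide) (by decide) (by decide))
  exact e.injective.moduleIsTorsionFree _ e.map_smul

lemma not_satisfiesSerre_two_of_linearEquiv (e : N ≃ₗ[ExRing k] columnCokernel (exColumn k) × G) :
    ¬ SatisfiesSerre (ExRing k) N 2 := by
  have := isPrime_exPrime k
  obtain ⟨l, hl⟩ := exists_dual_columnCokernel (y := exVar k 1) (z := exVar k 2) (w := exVar k 3)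
    (a := ![0, exVar k 3, -exVar k 2]) (by simp; ring)
  simp only [Matrix.cons_val, zero_mul, zero_add] at hl
  let E : (Fin 3 → ExRing k) →ₗ[ExRing k] N :=
    e.symm.toLinearMap ∘ₗ .inl _ _ _ ∘ₗ Submodule.mkQ _
  have hE : ∀ u, (l ∘ₗ .fst _ _ _ ∘ₗ e.toLinearMap) (E u) =
      exVar k 3 * u 1 + -exVar k 2 * u 2 := fun u => by
    rw [← hl]; simp [E]
  refine not_satisfiesSerre_two_of_relation (x := exVar k 0) (q := exPrime k) rfl
    (height_exPrime k).ge exVar_zero_mul_exVar_one exVar_zero_notMem_exPrime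
    (fun _ => eq_zero_of_exVar_mul_eq_zero (by decide) (by decide))
    (e₀ := E (Pi.single 0 1)) (e₁ := E (Pi.single 1 1)) (e₂ := E (Pi.single 2 1))
    (l := l ∘ₗ .fst _ _ _ ∘ₗ e.toLinearMap) ?_ ?_ ?_ fun n => ?_
  · rw [← map_smul, ← map_smul, ← map_smul, ← map_add, ← map_add]
    simp only [E, LinearMap.comp_apply]
    rw [mkQ_column_eq_zero_iff.mpr ⟨1, by simp⟩, map_zero, map_zero]
  · rw [hE]; simp
  · rw [hE]; simp
  · obtain ⟨u, hu⟩ := Submodule.mkQ_surjective _ (e n).1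
    change l (e n).1 ∈ _
    rw [← hu, hl]
    exact Ideal.add_mem _ (Ideal.mul_mem_right _ _ (Ideal.subset_span (by simp)))
      (Ideal.mul_mem_right _ _ (neg_mem (Ideal.subset_span (by simp))))

lemma isSMulRegular_exModule_exVar_two : IsSMulRegular (ExModule k) (exVar k 2) := by
  refine (isSMulRegular_quotient_iff_mem_of_smul_mem _ _).mpr fun r hr => ?_
  rw [Ideal.mem_span_singleton] at hr ⊢
  exact exVar_dvd_of_dvd_exVar_mul (by decide) (by decide) (by decide) hr

lemma torVanishes_of_linearEquiv [Module.Free (ExRing k) G]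
    (e : N ≃ₗ[ExRing k] columnCokernel (exColumn k) × G) :
    TorVanishes (ExRing k) (ExModule k) N :=
  torVanishes_of_exact _
    (injective_column fun _ => eq_zero_of_exVar_mul_eq_zero (by decide) (by decide))
    (surjective_column e) (exact_column e)
    (injective_lTensor_column isSMulRegular_exModule_exVar_two)

lemma projectiveDimension_eq_one_of_linearEquiv [Module.Finite (ExRing k) N]
    [Module.Free (ExRing k) G] (e : N ≃ₗ[ExRing k] columnCokernel (exColumn k) × G) :
    projectiveDimension (ModuleCat.of (ExRing k) N) = 1 :=
  projectiveDimension_eq_one_of_exact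
    (injective_column fun _ => eq_zero_of_exVar_mul_eq_zero (by decide) (by decide))
    (surjective_column e) (exact_column e)
    fun _ => not_isReflexive_of_linearEquiv e inferInstance

end

variable (k)

lemma exists_isAuslanderTranspose_exPrime :
    ∃ (N : Type u) (_ : AddCommGroup N) (_ : Module (ExRing k) N),
      IsAuslanderTranspose (ExRing k) (ExRing k ⧸ exPrime k) N := by
  rw [← span_range_exColumn]
  exact isAuslanderTranspose_exists _

variable {k} in
lemma exists_linearEquiv_of_isAuslanderTranspose_exPrime {N : Type u} [AddCommGroup N]
    [Module (ExRing k) N] (hN : IsAuslanderTranspose (ExRing k) (ExRing k ⧸ exPrime k) N) :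
    ∃ (G : Type u) (_ : AddCommGroup G) (_ : Module (ExRing k) G),
      Module.Finite (ExRing k) G ∧ Module.Free (ExRing k) G ∧
        Nonempty (N ≃ₗ[ExRing k] columnCokernel (exColumn k) × G) := by
  rw [← span_range_exColumn] at hN
  refine hN.exists_linearEquiv_columnCokernel_prod (fun i => ?_) fun c =>
    mem_maximalIdeal_of_sum_mul_exColumn_eq_zero
  fin_cases i <;> exact exVar_mem_maximalIdeal _

lemma satisfiesSerre_two_exRing_of_isReflexive (M : Type u) [AddCommGroup M] [Module (ExRing k) M]
    [Module.IsReflexive (ExRing k) M] : SatisfiesSerre (ExRing k) M 2 := by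
  refine satisfiesSerre_two_of_isReflexive (fun r hr => ?_) (isWeaklyRegular_exRing k)
    (ringKrullDim_exRing k).le
  simp only [List.mem_cons, List.not_mem_nil, or_false] at hr
  rcases hr with rfl | rfl | rfl
  · exact exVar_mem_maximalIdeal _
  · exact exVar_mem_maximalIdeal _
  · exact add_mem (exVar_mem_maximalIdeal _) (exVar_mem_maximalIdeal _)

lemma exVar_mem_maximalIdeal_of_mem_list :
    ∀ r ∈ [exVar k 1, exVar k 2, exVar k 3], r ∈ maximalIdeal (ExRing k) := by
  simp only [List.mem_cons, List.not_mem_nil, or_false]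
  rintro r (rfl | rfl | rfl) <;> exact exVar_mem_maximalIdeal _

lemma nontrivial_exModule : Nontrivial (ExModule k) :=
  Ideal.Quotient.nontrivial_iff.mpr fun h => (Ideal.ne_top_iff_one _).mp
    (Ideal.IsPrime.ne_top (I := maximalIdeal (ExRing k)) inferInstance)
    ((Ideal.span_singleton_le_iff_mem _).mpr (exVar_mem_maximalIdeal 0)
      (h ▸ Submodule.mem_top : (1 : ExRing k) ∈ _))

end TransposeOfExPrime

theorem mainTheorem2 (k : Type u) [Field k] :
    -- `R` is a three-dimensional hypersurface, `𝔭` is a prime of height two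
    IsCompleteIntersectionOfCodim (ExRing k) 1 ∧ ringKrullDim (ExRing k) = 3 ∧
    (exPrime k).IsPrime ∧ (exPrime k).height = 2 ∧
    -- `M` is maximal Cohen-Macaulay, satisfies every `(S_r)`, and is reflexive
    IsMaximalCohenMacaulay (ExRing k) (ExModule k) ∧
    (∀ r : ℕ, SatisfiesSerre (ExRing k) (ExModule k) r) ∧
    Module.IsReflexive (ExRing k) (ExModule k) ∧
    -- the transpose of `R / 𝔭` exists, and every choice `N` of it has the stated properties
    (∃ (N : Type u) (_ : AddCommGroup N) (_ : Module (ExRing k) N),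
      IsAuslanderTranspose (ExRing k) (ExRing k ⧸ exPrime k) N) ∧
    (∀ (N : Type u) [AddCommGroup N] [Module (ExRing k) N],
      IsAuslanderTranspose (ExRing k) (ExRing k ⧸ exPrime k) N →
        projectiveDimension (ModuleCat.of (ExRing k) N) = 1 ∧
        HasConstantRank (ExRing k) N ∧
        TorVanishes (ExRing k) (ExModule k) N ∧
        Module.IsReflexive (ExRing k) (ExModule k ⊗[ExRing k] N) ∧
        SatisfiesSerre (ExRing k) (ExModule k ⊗[ExRing k] N) 2 ∧
        Module.IsTorsionFree (ExRing k) N ∧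
        ¬ Module.IsReflexive (ExRing k) N ∧
        ¬ SatisfiesSerre (ExRing k) N 2) ∧
    -- both parts of the question have a negative answer
    ¬ HunekeWiegandPartOne.{u} ∧ ¬ HunekeWiegandPartTwo.{u} := by
  have hci := isCompleteIntersectionOfCodim_exRing k
  have : IsNoetherianRing (ExRing k) := hci.1
  have := nontrivial_exModule k
  have hlist := exVar_mem_maximalIdeal_of_mem_list k
  have hdim := ringKrullDim_exRing k
  have hall : ∀ (N : Type u) [AddCommGroup N] [Module (ExRing k) N],
      IsAuslanderTranspose (ExRing k) (ExRing k ⧸ exPrime k) N →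
        Module.Finite (ExRing k) N ∧
        projectiveDimension (ModuleCat.of (ExRing k) N) = 1 ∧
        HasConstantRank (ExRing k) N ∧
        TorVanishes (ExRing k) (ExModule k) N ∧
        Module.IsReflexive (ExRing k) (ExModule k ⊗[ExRing k] N) ∧
        SatisfiesSerre (ExRing k) (ExModule k ⊗[ExRing k] N) 2 ∧
        Module.IsTorsionFree (ExRing k) N ∧
        ¬ Module.IsReflexive (ExRing k) N ∧
        ¬ SatisfiesSerre (ExRing k) N 2 := by
    intro N _ _ hN
    obtain ⟨G, _, _, _, _, ⟨e⟩⟩ := exists_linearEquiv_of_isAuslanderTranspose_exPrime hN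
    have hfin : Module.Finite (ExRing k) N := Module.Finite.equiv e.symm
    have hrefl := isReflexive_exModule_tensor e
    exact ⟨hfin, projectiveDimension_eq_one_of_linearEquiv e,
      hasConstantRank_of_linearEquiv e
        (fun _ => eq_zero_of_exVar_mul_eq_zero (by decide) (by decide)),
      torVanishes_of_linearEquiv e, hrefl, satisfiesSerre_two_exRing_of_isReflexive k _,
      isTorsionFree_of_linearEquiv e, not_isReflexive_of_linearEquiv e,
      not_satisfiesSerre_two_of_linearEquiv e⟩
  have hex := exists_isAuslanderTranspose_exPrime k
  refine ⟨hci, hdim, isPrime_exPrime k, height_exPrime k,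
    isMaximalCohenMacaulay_of_isWeaklyRegular hlist (isWeaklyRegular_exModule k) hdim.le,
    satisfiesSerre_of_isWeaklyRegular hlist (isWeaklyRegular_exModule k) hdim.le,
    isReflexive_exModule k, hex, fun N _ _ hN => (hall N hN).2, fun h => ?_, fun h => ?_⟩
  all_goals
    obtain ⟨N, _, _, hN⟩ := hex
    obtain ⟨_, -, hrank, htor, -, hserre, -, hnrefl, hnserre⟩ := hall N hN
    have : Nontrivial N := by
      by_contra hN0
      have := not_nontrivial_iff_subsingleton.mp hN0
      exact hnrefl inferInstance
  · exact hnserre (h (ExRing k) 1 hci (ExModule k) N 2 one_le_two hserre htor).2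
  · exact hnrefl (h (ExRing k) hci (ExModule k) N hserre (Or.inr hrank)).2
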